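/- **Setting.** Let $A$ be a real $n\times m$ matrix with columns $A_1,\dots,A_m$, let $\sigma_{sys},\sigma_{obs}>0$ and $\lambda_m=\sqrt{2\log m}$. For $T\subseteq\{1,\dots,m\}$, $A_T$ is the submatrix of the columns in $T$ and $I_T$ is the $m\times m$ matrix that is the identity on $T\times T$ and zero elsewhere. $\delta_S$ is the restricted isometry constant of $A$, i.e. the smallest $\delta\ge 0$ with $(1-\delta)\|c\|_2^2\le\|A_Tc\|_2^2\le(1+\delta)\|c\|_2^2$ for all $|T|\le S$ and all $c$; $\theta_{S,S'}$ is the restricted orthogonality constant, i.e. the smallest $\theta\ge0$ with $|\langle A_Tc,A_{T'}c'\rangle|\le\theta\|c\|_2\|c'\|_2$ for all disjoint $T,T'$ with $|T|\le S$, $|T'|\le S'$ and all $c,c'$. **Model.** Let $N_t\subseteq\{1,\dots,m\}$, $t\ge 0$, be deterministic sets, and let, for $t\ge1$, $$x_0=0,\qquad x_t=x_{t-1}+\nu_t,\qquad \nu_t\sim\mathcal N(0,\sigma_{sys}^2 I_{N_t}),\qquad y_t=Ax_t+w_t,$$ where the $w_t$ are i.i.d. with mean $0$ and covariance $\sigma_{obs}^2I$,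 all the vectors $\nu_1,w_1,\nu_2,w_2,\dots$ are independent, and, almost surely, every coordinate of $w_t$ is bounded in absolute value by $\lambda_m\sigma_{obs}/\max_i\|A_i\|_1$. **Algorithms.** For data $r\in\mathbb R^n$ let a Dantzig selector be any $\hat\beta$ that minimizes $\|\beta\|_1$ subject to $\|A'(r-A\beta)\|_\infty\le\lambda_m\sigma_{obs}$. Fix an addition threshold $\alpha_a$ and any real $\alpha_{fe}$. For a predicted covariance $P$ put $\Sigma=APA'+\sigma_{obs}^2I$ and $K=PA'\Sigma^{-1}$. The LS estimate on $T$ equals $(A_T'A_T)^{-1}A_T'y_t$ on $T$ and $0$ off $T$. *KF-CS with final LS and without deletion:* $\hat x_0=0$, $P_0=0$, and $T_0=\emptyset$ or $T_0=N_0$. At time $t\ge1$, compute $K$ and $\Sigma$ from $P=P_{t-1}+\sigma_{sys}^2I_{T_{t-1}}$, put $\hat x_{t,tmp}=(I-KA)\hat x_{t-1}+Ky_t$, $r_t=y_t-A\hat x_{t,tmp}$ and $\Sigma_{fe}=(I-AK)\Sigma(I-AK)'$. If $r_t'\Sigma_{fe}^{-1}r_t>\alpha_{fe}$, then $T_t=T_{t-1}\cup\{i\notin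 T_{t-1}:\hat\beta_i^2>\alpha_a\}$ with a Dantzig selector $\hat\beta$ for $r_t$; otherwise $T_t=T_{t-1}$. If $T_t\ne T_{t-1}$, then $\hat x_t$ is the LS estimate on $T_t$, and $P_t$ equals $\sigma_{obs}^2(A_{T_t}'A_{T_t})^{-1}$ on $T_t\times T_t$ and $0$ elsewhere. If $T_t=T_{t-1}$, then with $P=P_{t-1}+\sigma_{sys}^2I_{T_t}$ and the corresponding $K$, $\hat x_t=(I-KA)\hat x_{t-1}+Ky_t$ and $P_t=(I-KA)P$. *LS-CS:* $T_0$ is as above; $r_t=y_t-A\hat x_{t,tmp}$ with $\hat x_{t,tmp}$ the LS estimate on $T_{t-1}$; $T_t$ is obtained from $r_t$ as above if $\|r_t\|_2^2/\sigma_{obs}^2>\alpha_{fe}$, and $T_t=T_{t-1}$ otherwise (for $\alpha_{fe}<0$ the CS step is always performed); $\hat x_t$ is the LS estimate on $T_t$. *Genie-aided KF:* $\hat x_{0}=0$, $P_0=0$, and at each $t\ge 1$ the Kalman step with $P=P_{t-1}+\sigma_{sys}^2I_{N_t}$. *Genie-aided LS:* the LS estimate on $N_t$. **Theorem.** Assume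 that, for some integers $S_{max},S_{fa}\ge0$, (i) $N_{t-1}\subseteq N_t$ and $|N_t|\le S_{max}$ for all $t$; almost surely $|T_t\setminus N_t|\le S_{fa}$ for all $t$, for the algorithm under consideration; $\delta_{S_{max}+S_{fa}}<1$; and $\delta_{2S_{max}}+\delta_{3S_{max}}<1$; (ii) $\alpha_a=B_1:=C_1^2\lambda_m^2S_{max}\sigma_{obs}^2$, where $C_1=4/(1-\delta_{2S_{max}}-\theta_{S_{max},2S_{max}})$; (iii) there is a finite time $t_{a,max}$ with $N_t=N_{t_{a,max}}$ for all $t\ge t_{a,max}$. Then the difference between the genie-aided KF estimate and the estimate $\hat x_t$ of KF-CS with final LS and without deletion converges to zero in probability as $t\to\infty$. Likewise, the difference between the genie-aided LS estimate and the LS-CS estimate converges to zero in probability as $t\to\infty$. -/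

import Mathlib

open MeasureTheory ProbabilityTheory Filter
open scoped Matrix

noncomputable section

namespace KFCS

variable {m n : ℕ}

/-- Squared Euclidean norm of a vector. -/
def sqNorm {ι : Type*} [Fintype ι] (v : ι → ℝ) : ℝ := ∑ i, v i ^ 2

/-- The vector `v` vanishes off `T`. -/
def SupportedOn (T : Finset (Fin m)) (v : Fin m → ℝ) : Prop := ∀ i, i ∉ T → v i = 0

/-- The restricted isometry constant `δ_S(A)`: the smallest `δ ≥ 0` such that
`(1 - δ) ‖c‖² ≤ ‖A_T c‖² ≤ (1 + δ) ‖c‖²` for all column sets `T` with `|T| ≤ S` and all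
coefficient vectors `c` (here: all vectors `c` vanishing off `T`, for which `A c = A_T c_T`). -/
def ripConst (A : Matrix (Fin n) (Fin m) ℝ) (S : ℕ) : ℝ :=
  sInf {δ : ℝ | 0 ≤ δ ∧ ∀ T : Finset (Fin m), T.card ≤ S → ∀ c : Fin m → ℝ, SupportedOn T c →
    (1 - δ) * sqNorm c ≤ sqNorm (A *ᵥ c) ∧ sqNorm (A *ᵥ c) ≤ (1 + δ) * sqNorm c}

/-- The restricted orthogonality constant `θ_{S,S'}(A)`: the smallest `θ ≥ 0` such that
`|⟨A_T c, A_T' c'⟩| ≤ θ ‖c‖ ‖c'‖` for all disjoint `T`, `T'` with `|T| ≤ S`, `|T'| ≤ S'`. -/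
def ropConst (A : Matrix (Fin n) (Fin m) ℝ) (S S' : ℕ) : ℝ :=
  sInf {θ : ℝ | 0 ≤ θ ∧ ∀ T T' : Finset (Fin m), T.card ≤ S → T'.card ≤ S' → Disjoint T T' →
    ∀ c c' : Fin m → ℝ, SupportedOn T c → SupportedOn T' c' →
      |(A *ᵥ c) ⬝ᵥ (A *ᵥ c')| ≤ θ * (Real.sqrt (sqNorm c) * Real.sqrt (sqNorm c'))}

/-- The constant `λ_m = √(2 log m)`. -/
def lam (m : ℕ) : ℝ := Real.sqrt (2 * Real.log m)

/-- The constant `C₁ = 4 / (1 - δ_{2S} - θ_{S,2S})` of the error bound for the Dantzig selector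
on `S`-sparse vectors. -/
def dantzigC1 (A : Matrix (Fin n) (Fin m) ℝ) (S : ℕ) : ℝ :=
  4 / (1 - ripConst A (2 * S) - ropConst A S (2 * S))

/-- The threshold `B₁ = C₁² λ_m² S σ_obs²`. -/
def threshB1 (A : Matrix (Fin n) (Fin m) ℝ) (S : ℕ) (σobs : ℝ) : ℝ :=
  dantzigC1 A S ^ 2 * lam m ^ 2 * S * σobs ^ 2

/-- The largest `ℓ¹` norm of a column of `A`. -/
def maxColL1 (A : Matrix (Fin n) (Fin m) ℝ) : ℝ := ⨆ i : Fin m, ∑ k : Fin n, |A k i|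

/-- `β` is feasible for the Dantzig selector with data `r` and level `ρ`:
`‖A' (r - A β)‖_∞ ≤ ρ`. -/
def DSFeasible (A : Matrix (Fin n) (Fin m) ℝ) (ρ : ℝ) (r : Fin n → ℝ) (β : Fin m → ℝ) : Prop :=
  ∀ i, |(Aᵀ *ᵥ (r - A *ᵥ β)) i| ≤ ρ

/-- `β` is a Dantzig selector for `r`: a feasible vector of least `ℓ¹` norm. -/
def IsDantzigSelector (A : Matrix (Fin n) (Fin m) ℝ) (ρ : ℝ) (r : Fin n → ℝ)
    (β : Fin m → ℝ) : Prop :=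
  DSFeasible A ρ r β ∧ ∀ β' : Fin m → ℝ, DSFeasible A ρ r β' → ∑ i, |β i| ≤ ∑ i, |β' i|

/-- The set `{i ∉ T : β_i² > αa}` of detected additions. -/
def additions (αa : ℝ) (T : Finset (Fin m)) (β : Fin m → ℝ) : Finset (Fin m) :=
  Finset.univ.filter fun i => i ∉ T ∧ αa < β i ^ 2

/-- `T'` is the support estimate obtained from the previous estimate `T` and the residual `r` by
the Dantzig selector followed by thresholding. If there are several Dantzig selectors, any of
them may be used. -/
def CSUpdate (A : Matrix (Fin n) (Fin m) ℝ) (σobs αa : ℝ) (T : Finset (Fin m)) (r : Fin n → ℝ)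
    (T' : Finset (Fin m)) : Prop :=
  ∃ β : Fin m → ℝ, IsDantzigSelector A (lam m * σobs) r β ∧ T' = T ∪ additions αa T β

/-! ### Least squares -/

/-- The submatrix `A_T` of the columns in `T`. -/
def colSub (A : Matrix (Fin n) (Fin m) ℝ) (T : Finset (Fin m)) : Matrix (Fin n) T ℝ :=
  A.submatrix id Subtype.val

/-- The least squares estimate on `T`: `(A_T' A_T)⁻¹ A_T' y` on `T`, zero off `T`. -/
def lsEst (A : Matrix (Fin n) (Fin m) ℝ) (T : Finset (Fin m)) (y : Fin n → ℝ) : Fin m → ℝ :=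
  fun i => if h : i ∈ T then
    (((colSub A T)ᵀ * colSub A T)⁻¹ *ᵥ ((colSub A T)ᵀ *ᵥ y)) ⟨i, h⟩ else 0

/-- The least squares covariance: `(A_T' A_T)⁻¹ σ_obs²` on `T × T`, zero elsewhere. -/
def lsCov (A : Matrix (Fin n) (Fin m) ℝ) (σobs : ℝ) (T : Finset (Fin m)) :
    Matrix (Fin m) (Fin m) ℝ :=
  Matrix.of fun i j => if h : i ∈ T ∧ j ∈ T then
    ((colSub A T)ᵀ * colSub A T)⁻¹ ⟨i, h.1⟩ ⟨j, h.2⟩ * σobs ^ 2 else 0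

/-! ### The Kalman filter -/

/-- `σ² I_T`, where `I_T` is the identity on `T × T` and zero elsewhere. -/
def diagOn (σ : ℝ) (T : Finset (Fin m)) : Matrix (Fin m) (Fin m) ℝ :=
  Matrix.diagonal fun i => if i ∈ T then σ ^ 2 else 0

/-- The innovation covariance `A P A' + σ_obs² I` for the predicted covariance `P`. -/
def innovCov (A : Matrix (Fin n) (Fin m) ℝ) (σobs : ℝ) (P : Matrix (Fin m) (Fin m) ℝ) :
    Matrix (Fin n) (Fin n) ℝ :=
  A * P * Aᵀ + σobs ^ 2 • (1 : Matrix (Fin n) (Fin n) ℝ)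

/-- The Kalman gain `P A' (A P A' + σ_obs² I)⁻¹` for the predicted covariance `P`. -/
def gain (A : Matrix (Fin n) (Fin m) ℝ) (σobs : ℝ) (P : Matrix (Fin m) (Fin m) ℝ) :
    Matrix (Fin m) (Fin n) ℝ :=
  P * Aᵀ * (innovCov A σobs P)⁻¹

/-- The Kalman state update `(I - K A) x + K y` for the predicted covariance `P`. -/
def kfState (A : Matrix (Fin n) (Fin m) ℝ) (σobs : ℝ) (P : Matrix (Fin m) (Fin m) ℝ)
    (x : Fin m → ℝ) (y : Fin n → ℝ) : Fin m → ℝ :=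
  (1 - gain A σobs P * A) *ᵥ x + gain A σobs P *ᵥ y

/-- The Kalman covariance update `(I - K A) P` for the predicted covariance `P`. -/
def kfCov (A : Matrix (Fin n) (Fin m) ℝ) (σobs : ℝ) (P : Matrix (Fin m) (Fin m) ℝ) :
    Matrix (Fin m) (Fin m) ℝ :=
  (1 - gain A σobs P * A) * P

/-- The filtering error covariance `(I - A K) (A P A' + σ_obs² I) (I - A K)'`. -/
def filtErrCov (A : Matrix (Fin n) (Fin m) ℝ) (σobs : ℝ) (P : Matrix (Fin m) (Fin m) ℝ) :
    Matrix (Fin n) (Fin n) ℝ :=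
  (1 - A * gain A σobs P) * innovCov A σobs P * (1 - A * gain A σobs P)ᵀ

/-- Covariances `P_t` of the genie-aided Kalman filter, which knows the supports `N_t`. -/
def gaKFCov (A : Matrix (Fin n) (Fin m) ℝ) (σsys σobs : ℝ) (N : ℕ → Finset (Fin m)) :
    ℕ → Matrix (Fin m) (Fin m) ℝ
  | 0 => 0
  | t + 1 => kfCov A σobs (gaKFCov A σsys σobs N t + diagOn σsys (N (t + 1)))

/-- The estimates of the genie-aided Kalman filter from the observations `y`. -/
def gaKF (A : Matrix (Fin n) (Fin m) ℝ) (σsys σobs : ℝ) (N : ℕ → Finset (Fin m))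
    (y : ℕ → Fin n → ℝ) : ℕ → Fin m → ℝ
  | 0 => 0
  | t + 1 => kfState A σobs (gaKFCov A σsys σobs N t + diagOn σsys (N (t + 1)))
      (gaKF A σsys σobs N y t) (y (t + 1))

/-! ### The algorithms -/

/-- Residual of the temporary Kalman prediction and update, with predicted covariance `P`. -/
def kfResidual (A : Matrix (Fin n) (Fin m) ℝ) (σobs : ℝ) (P : Matrix (Fin m) (Fin m) ℝ)
    (x : Fin m → ℝ) (y : Fin n → ℝ) : Fin n → ℝ :=
  y - A *ᵥ kfState A σobs P x y

/-- The filtering error norm `r' Σ_fe⁻¹ r` of the temporary Kalman step. -/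
def kfFEN (A : Matrix (Fin n) (Fin m) ℝ) (σobs : ℝ) (P : Matrix (Fin m) (Fin m) ℝ)
    (x : Fin m → ℝ) (y : Fin n → ℝ) : ℝ :=
  kfResidual A σobs P x y ⬝ᵥ ((filtErrCov A σobs P)⁻¹ *ᵥ kfResidual A σobs P x y)

/-- `(T, xhat, P)` is a run of KF-CS with final LS and without deletion on the observations `y`,
with initial support estimate `T0`. -/
structure IsKFCSRun (A : Matrix (Fin n) (Fin m) ℝ) (σsys σobs αa αfe : ℝ) (T0 : Finset (Fin m))
    (y : ℕ → Fin n → ℝ) (T : ℕ → Finset (Fin m)) (xhat : ℕ → Fin m → ℝ)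
    (P : ℕ → Matrix (Fin m) (Fin m) ℝ) : Prop where
  T_zero : T 0 = T0
  xhat_zero : xhat 0 = 0
  P_zero : P 0 = 0
  /-- If the filtering error norm is large, CS on the Kalman filtering error. -/
  detect : ∀ t, αfe < kfFEN A σobs (P t + diagOn σsys (T t)) (xhat t) (y (t + 1)) →
    CSUpdate A σobs αa (T t)
      (kfResidual A σobs (P t + diagOn σsys (T t)) (xhat t) (y (t + 1))) (T (t + 1))
  no_detect : ∀ t, ¬ αfe < kfFEN A σobs (P t + diagOn σsys (T t)) (xhat t) (y (t + 1)) →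
    T (t + 1) = T t
  /-- Final LS when the support estimate has changed. -/
  final_ls : ∀ t, T (t + 1) ≠ T t →
    xhat (t + 1) = lsEst A (T (t + 1)) (y (t + 1)) ∧ P (t + 1) = lsCov A σobs (T (t + 1))
  /-- Kalman prediction and update otherwise. -/
  kalman : ∀ t, T (t + 1) = T t →
    xhat (t + 1) = kfState A σobs (P t + diagOn σsys (T (t + 1))) (xhat t) (y (t + 1)) ∧
    P (t + 1) = kfCov A σobs (P t + diagOn σsys (T (t + 1)))

/-- Residual `y - A x_tmp` of the least squares estimate on `T`. -/
def lsResidual (A : Matrix (Fin n) (Fin m) ℝ) (T : Finset (Fin m)) (y : Fin n → ℝ) : Fin n → ℝ :=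
  y - A *ᵥ lsEst A T y

/-- `(T, xhat)` is a run of LS-CS (without deletion) on the observations `y`, with initial support
estimate `T0`. CS is done on the LS error whenever its normalized energy `‖r‖² / σ_obs²` exceeds
`αfe`; a negative `αfe` means that it is done at every time. The choice of Dantzig selector is
free, as in KF-CS. -/
structure IsLSCSRun (A : Matrix (Fin n) (Fin m) ℝ) (σobs αa αfe : ℝ) (T0 : Finset (Fin m))
    (y : ℕ → Fin n → ℝ) (T : ℕ → Finset (Fin m)) (xhat : ℕ → Fin m → ℝ) : Prop where
  T_zero : T 0 = T0
  xhat_zero : xhat 0 = 0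
  detect : ∀ t, αfe < sqNorm (lsResidual A (T t) (y (t + 1))) / σobs ^ 2 →
    CSUpdate A σobs αa (T t) (lsResidual A (T t) (y (t + 1))) (T (t + 1))
  no_detect : ∀ t, ¬ αfe < sqNorm (lsResidual A (T t) (y (t + 1))) / σobs ^ 2 →
    T (t + 1) = T t
  final_ls : ∀ t, xhat (t + 1) = lsEst A (T (t + 1)) (y (t + 1))

/-! ### The signal and observation model -/

/-- The law `𝒩(0, σ² I_T)`: independent centred Gaussian coordinates, of variance `σ²` on `T` and
variance zero off `T`. -/
def gaussOn (σ : ℝ) (T : Finset (Fin m)) : Measure (Fin m → ℝ) :=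
  Measure.pi fun i => gaussianReal 0 (if i ∈ T then Real.toNNReal (σ ^ 2) else 0)

/-- The model `x_0 = 0`, `x_t = x_{t-1} + ν_t`, `y_t = A x_t + w_t` for `t ≥ 1`, with
`ν_t ~ 𝒩(0, σ_sys² I_{N_t})`, with i.i.d. noise `w_t` of mean zero and covariance `σ_obs² I` that is
bounded by `λ_m σ_obs / max_i ‖A_i‖₁` in every coordinate, and with all the `ν_t` and `w_t`
independent. -/
structure IsModel {Ω : Type*} [MeasurableSpace Ω] (μ : Measure Ω)
    (A : Matrix (Fin n) (Fin m) ℝ) (σsys σobs : ℝ) (N : ℕ → Finset (Fin m))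
    (x ν : ℕ → Ω → Fin m → ℝ) (w y : ℕ → Ω → Fin n → ℝ) : Prop where
  x_zero : ∀ ω, x 0 ω = 0
  x_succ : ∀ t ω, x (t + 1) ω = x t ω + ν (t + 1) ω
  obs : ∀ t ω, y (t + 1) ω = A *ᵥ x (t + 1) ω + w (t + 1) ω
  meas_ν : ∀ t, Measurable (ν (t + 1))
  meas_w : ∀ t, Measurable (w (t + 1))
  law_ν : ∀ t, μ.map (ν (t + 1)) = gaussOn σsys (N (t + 1))
  ident_w : ∀ t, IdentDistrib (w (t + 1)) (w 1) μ μ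
  mean_w : ∀ t i, ∫ ω, w (t + 1) ω i ∂μ = 0
  cov_w : ∀ t i j, ∫ ω, w (t + 1) ω i * w (t + 1) ω j ∂μ = if i = j then σobs ^ 2 else 0
  bdd_w : ∀ t, ∀ᵐ ω ∂μ, ∀ i, |w (t + 1) ω i| * maxColL1 A ≤ lam m * σobs
  /-- `ν_1, w_1, ν_2, w_2, …` are mutually independent (stated for the generated σ-algebras, since
  the two kinds of vectors have different dimensions). -/
  indep : iIndep (Sum.elim
    (fun t : ℕ => MeasurableSpace.comap (ν (t + 1)) inferInstance)
    (fun t : ℕ => MeasurableSpace.comap (w (t + 1)) inferInstance)) μ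

end KFCS

end

/-!
Why the theorem is true. By hypothesis `δ_{2S} + θ_{S,2S} ≤ δ_{2S} + δ_{3S} < 1`, so the
Candès–Tao estimate (`IsDantzigSelector.sqNorm_sub_le`) bounds the error of every Dantzig selector
by `√B₁` as soon as the vector that it estimates, the difference of the signal and the temporary
estimate, is `S`-sparse and feasible; the bound on the noise makes it feasible. Hence
(`CSUpdate.subset_and_mem`) no coordinate outside `N_t` is ever added: by induction
`T_t ⊆ N_t`, which in turn keeps the error vector `S`-sparse. Conversely, a missed coordinate is
found as soon as the signal there is large: the Dantzig selector then exceeds the threshold, and the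
Dantzig selector is in fact run, because the filtering error norm is at least the normalized energy
of the residual (`sqNorm_kfResidual_le`) and that energy is large (`lt_sqNorm_residual`). After the
last addition to `N_t` the coordinates of the signal in the final support `N` are Gaussian with
variances that tend to infinity, so `T_t = N` with probability tending to one
(`IsModel.tendsto_measure_not_large`, `support_eq_of_large`).

For LS-CS the two estimates agree once `T_t = N`. For KF-CS what remains is to compare two Kalman
filters on the same support and with the same data, started from different estimates and
covariances. With `Φ` the transition matrix of the first filter, the difference of the covariances
at time `t` is `Φ (P_0 - P'_0) Ψᵀ`, where `Ψ` is the transition matrix of the second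
(`IsRiccati.sub_eq`), and the difference of the states is `Φ (x_0 - x'_0 + (P_0 - P'_0) g)`, where
`g` is a weighted sum of innovations of the second filter (`IsRiccati.kf_sub_eq`). The Riccati
recursion itself shows that `Φ` decays geometrically (`exists_trans_bound`): the posterior
covariances are bounded by a constant multiple of the identity on `N`, because `A` is injective
there, so each prediction step inflates them by a fixed factor. The remaining factor is linear in
time and in the accumulated norms of the data, whose first moments grow quadratically, so Markov's
inequality finishes the proof.
-/

namespace KFCS

variable {m n : ℕ}

/-! ### Restricted isometry and restricted orthogonality -/

/-- The vector `v` with its coordinates outside `U` replaced by zero. -/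
def restrictTo (U : Finset (Fin m)) (v : Fin m → ℝ) : Fin m → ℝ := fun i => if i ∈ U then v i else 0

lemma supportedOn_restrictTo (U : Finset (Fin m)) (v : Fin m → ℝ) :
    SupportedOn U (restrictTo U v) := fun i hi => by simp [restrictTo, hi]

lemma SupportedOn.mono {T U : Finset (Fin m)} (h : T ⊆ U) {v : Fin m → ℝ}
    (hv : SupportedOn T v) : SupportedOn U v := fun i hi => hv i fun hT => hi (h hT)

lemma SupportedOn.sub {T : Finset (Fin m)} {v w : Fin m → ℝ} (hv : SupportedOn T v)
    (hw : SupportedOn T w) : SupportedOn T (v - w) := fun i hi => by simp [hv i hi, hw i hi]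

lemma SupportedOn.add {T : Finset (Fin m)} {v w : Fin m → ℝ} (hv : SupportedOn T v)
    (hw : SupportedOn T w) : SupportedOn T (v + w) := fun i hi => by simp [hv i hi, hw i hi]

lemma SupportedOn.smul {T : Finset (Fin m)} {v : Fin m → ℝ} (hv : SupportedOn T v) (a : ℝ) :
    SupportedOn T (a • v) := fun i hi => by simp [hv i hi]

lemma sqNorm_nonneg {ι : Type*} [Fintype ι] (v : ι → ℝ) : 0 ≤ sqNorm v :=
  Finset.sum_nonneg fun _ _ => sq_nonneg _

lemma sqNorm_eq_dotProduct {ι : Type*} [Fintype ι] (v : ι → ℝ) : sqNorm v = v ⬝ᵥ v := by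
  simp [sqNorm, dotProduct, sq]

lemma sqNorm_eq_zero {ι : Type*} [Fintype ι] {v : ι → ℝ} : sqNorm v = 0 ↔ v = 0 := by
  rw [sqNorm_eq_dotProduct, dotProduct_self_eq_zero]

lemma sqNorm_smul {ι : Type*} [Fintype ι] (a : ℝ) (v : ι → ℝ) :
    sqNorm (a • v) = a ^ 2 * sqNorm v := by
  simp [sqNorm, mul_pow, Finset.mul_sum]

lemma sqNorm_add {ι : Type*} [Fintype ι] (v w : ι → ℝ) :
    sqNorm (v + w) = sqNorm v + 2 * (v ⬝ᵥ w) + sqNorm w := by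
  simp only [sqNorm_eq_dotProduct, add_dotProduct, dotProduct_add, dotProduct_comm w v]
  ring

lemma sqNorm_sub {ι : Type*} [Fintype ι] (v w : ι → ℝ) :
    sqNorm (v - w) = sqNorm v - 2 * (v ⬝ᵥ w) + sqNorm w := by
  simp only [sqNorm_eq_dotProduct, sub_dotProduct, dotProduct_sub, dotProduct_comm w v]
  ring

lemma sq_le_sqNorm {ι : Type*} [Fintype ι] (v : ι → ℝ) (i : ι) : v i ^ 2 ≤ sqNorm v :=
  Finset.single_le_sum (f := fun i => v i ^ 2) (fun _ _ => sq_nonneg _) (Finset.mem_univ i)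

lemma dotProduct_sq_le {ι : Type*} [Fintype ι] (v w : ι → ℝ) :
    (v ⬝ᵥ w) ^ 2 ≤ sqNorm v * sqNorm w :=
  Finset.sum_mul_sq_le_sq_mul_sq _ _ _

lemma sqNorm_mulVec_le {ι κ : Type*} [Fintype ι] [Fintype κ] (A : Matrix ι κ ℝ) (v : κ → ℝ) :
    sqNorm (A *ᵥ v) ≤ (∑ i, sqNorm (A i)) * sqNorm v := by
  rw [Finset.sum_mul]
  exact Finset.sum_le_sum fun i _ => dotProduct_sq_le (A i) v

lemma ripConst_mem (A : Matrix (Fin n) (Fin m) ℝ) (S : ℕ) :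
    0 ≤ ripConst A S ∧ ∀ T : Finset (Fin m), T.card ≤ S → ∀ c : Fin m → ℝ, SupportedOn T c →
      (1 - ripConst A S) * sqNorm c ≤ sqNorm (A *ᵥ c) ∧
        sqNorm (A *ᵥ c) ≤ (1 + ripConst A S) * sqNorm c := by
  refine IsClosed.csInf_mem (s := {δ : ℝ | 0 ≤ δ ∧ ∀ T : Finset (Fin m), T.card ≤ S →
    ∀ c : Fin m → ℝ, SupportedOn T c →
    (1 - δ) * sqNorm c ≤ sqNorm (A *ᵥ c) ∧ sqNorm (A *ᵥ c) ≤ (1 + δ) * sqNorm c}) ?_ ?_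
    ⟨0, fun δ hδ => hδ.1⟩
  · simp only [Set.ofPred_and, Set.ofPred_forall]
    refine isClosed_Ici.inter (isClosed_iInter fun T => isClosed_iInter fun _ =>
      isClosed_iInter fun c => isClosed_iInter fun _ => IsClosed.inter ?_ ?_)
    · exact isClosed_le (by fun_prop) (by fun_prop)
    · exact isClosed_le (by fun_prop) (by fun_prop)
  · have h0 : 0 ≤ ∑ i, sqNorm (A i) := Finset.sum_nonneg fun _ _ => sqNorm_nonneg _
    refine ⟨1 + ∑ i, sqNorm (A i), by positivity, fun T _ c _ => ⟨?_, ?_⟩⟩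
    · have := mul_nonneg h0 (sqNorm_nonneg c)
      nlinarith [sqNorm_nonneg (A *ᵥ c)]
    · nlinarith [sqNorm_mulVec_le A c, sqNorm_nonneg c]

lemma ripConst_nonneg (A : Matrix (Fin n) (Fin m) ℝ) (S : ℕ) : 0 ≤ ripConst A S :=
  (ripConst_mem A S).1

lemma ripConst_lower (A : Matrix (Fin n) (Fin m) ℝ) {S : ℕ} {T : Finset (Fin m)}
    (hT : T.card ≤ S) {c : Fin m → ℝ} (hc : SupportedOn T c) :
    (1 - ripConst A S) * sqNorm c ≤ sqNorm (A *ᵥ c) := ((ripConst_mem A S).2 T hT c hc).1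

/-- The parallelogram identity, applied to vectors rescaled to a common length, bounds the
restricted orthogonality constant by a restricted isometry constant. -/
lemma abs_dotProduct_le_ripConst (A : Matrix (Fin n) (Fin m) ℝ) {S S' : ℕ}
    {T T' : Finset (Fin m)} (hT : T.card ≤ S) (hT' : T'.card ≤ S') (hd : Disjoint T T')
    {c c' : Fin m → ℝ} (hc : SupportedOn T c) (hc' : SupportedOn T' c') :
    |(A *ᵥ c) ⬝ᵥ (A *ᵥ c')| ≤ ripConst A (S + S') * (√(sqNorm c) * √(sqNorm c')) := by
  set δ := ripConst A (S + S')
  set a := √(sqNorm c)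
  set b := √(sqNorm c')
  have ha : a ^ 2 = sqNorm c := Real.sq_sqrt (sqNorm_nonneg c)
  have hb : b ^ 2 = sqNorm c' := Real.sq_sqrt (sqNorm_nonneg c')
  have ha0 : 0 ≤ a := Real.sqrt_nonneg _
  have hb0 : 0 ≤ b := Real.sqrt_nonneg _
  have hcard : (T ∪ T').card ≤ S + S' := (Finset.card_union_le _ _).trans (by omega)
  have hu : SupportedOn (T ∪ T') (b • c) := (hc.mono Finset.subset_union_left).smul b
  have hv : SupportedOn (T ∪ T') (a • c') := (hc'.mono Finset.subset_union_right).smul a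
  have hcc : c ⬝ᵥ c' = 0 := by
    refine Finset.sum_eq_zero fun i _ => ?_
    by_cases h : i ∈ T
    · rw [hc' i (Finset.disjoint_left.mp hd h), mul_zero]
    · rw [hc i h, zero_mul]
  have hp := (ripConst_mem A (S + S')).2 _ hcard _ (hu.add hv)
  have hm := (ripConst_mem A (S + S')).2 _ hcard _ (hu.sub hv)
  simp only [Matrix.mulVec_add, Matrix.mulVec_sub, Matrix.mulVec_smul, sqNorm_add, sqNorm_sub,
    sqNorm_smul, smul_dotProduct, dotProduct_smul, hcc, smul_eq_mul, ← ha, ← hb] at hp hm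
  set z := (A *ᵥ c) ⬝ᵥ (A *ᵥ c')
  by_cases hab : a * b = 0
  · have h1 : sqNorm c * sqNorm c' = 0 := by rw [← ha, ← hb, ← mul_pow, hab]; simp
    have hz : z = 0 := by
      rcases mul_eq_zero.mp h1 with h | h <;> simp [z, sqNorm_eq_zero.mp h]
    simp [hz, hab]
  · have hab' : 0 < a * b := lt_of_le_of_ne (by positivity) (Ne.symm hab)
    rw [abs_le]
    constructor <;> refine le_of_mul_le_mul_left ?_ hab' <;> nlinarith

lemma ropConst_mem (A : Matrix (Fin n) (Fin m) ℝ) (S S' : ℕ) :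
    0 ≤ ropConst A S S' ∧ ∀ T T' : Finset (Fin m), T.card ≤ S → T'.card ≤ S' → Disjoint T T' →
    ∀ c c' : Fin m → ℝ, SupportedOn T c → SupportedOn T' c' →
      |(A *ᵥ c) ⬝ᵥ (A *ᵥ c')| ≤ ropConst A S S' * (√(sqNorm c) * √(sqNorm c')) := by
  refine IsClosed.csInf_mem (s := {θ : ℝ | 0 ≤ θ ∧ ∀ T T' : Finset (Fin m), T.card ≤ S →
    T'.card ≤ S' → Disjoint T T' →
    ∀ c c' : Fin m → ℝ, SupportedOn T c → SupportedOn T' c' →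
      |(A *ᵥ c) ⬝ᵥ (A *ᵥ c')| ≤ θ * (√(sqNorm c) * √(sqNorm c'))}) ?_
    ⟨ripConst A (S + S'), ripConst_nonneg _ _,
      fun T T' hT hT' hd c c' hc hc' => abs_dotProduct_le_ripConst A hT hT' hd hc hc'⟩
    ⟨0, fun δ hδ => hδ.1⟩
  simp only [Set.ofPred_and, Set.ofPred_forall]
  refine isClosed_Ici.inter (isClosed_iInter fun T => isClosed_iInter fun _ =>
    isClosed_iInter fun c => isClosed_iInter fun _ => isClosed_iInter fun _ =>
    isClosed_iInter fun _ => isClosed_iInter fun _ => isClosed_iInter fun _ =>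
    isClosed_iInter fun _ => ?_)
  exact isClosed_le (by fun_prop) (by fun_prop)

lemma ropConst_le_ripConst (A : Matrix (Fin n) (Fin m) ℝ) (S S' : ℕ) :
    ropConst A S S' ≤ ripConst A (S + S') :=
  csInf_le ⟨0, fun _ hδ => hδ.1⟩ ⟨ripConst_nonneg _ _,
    fun _ _ hT hT' hd _ _ hc hc' => abs_dotProduct_le_ripConst A hT hT' hd hc hc'⟩

/-! ### The error bound for the Dantzig selector -/

/-- A set `V` of (at most) `S` largest entries of `h` on `U`: an entry left over is at most the
average over `V`. -/
lemma exists_largest (h : Fin m → ℝ) (U : Finset (Fin m)) (S : ℕ) :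
    ∃ V ⊆ U, V.card = min S U.card ∧ ∀ j ∈ U \ V, S * |h j| ≤ ∑ i ∈ V, |h i| := by
  suffices H : ∃ V ⊆ U, V.card = min S U.card ∧ ∀ j ∈ U \ V, ∀ i ∈ V, |h j| ≤ |h i| by
    obtain ⟨V, hVU, hc, hV⟩ := H
    refine ⟨V, hVU, hc, fun j hj => ?_⟩
    have hlt : V.card < U.card := Finset.card_lt_card <|
      Finset.ssubset_iff_subset_ne.mpr ⟨hVU, fun e => by simp [e] at hj⟩
    have hS : V.card = S := by omega
    rw [← hS, ← nsmul_eq_mul]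
    exact Finset.card_nsmul_le_sum _ _ _ (hV j hj)
  induction S with
  | zero => exact ⟨∅, by simp⟩
  | succ S ih =>
    obtain ⟨V, hVU, hc, hV⟩ := ih
    rcases (U \ V).eq_empty_or_nonempty with h0 | h0
    · have hUV : U = V := (Finset.sdiff_eq_empty_iff_subset.mp h0).antisymm hVU
      refine ⟨V, hVU, ?_, by simp [hUV]⟩
      rw [hUV] at hc ⊢
      omega
    · obtain ⟨j, hj, hmax⟩ := Finset.exists_max_image (U \ V) (fun i => |h i|) h0
      have hjU := Finset.mem_sdiff.mp hj
      have hlt : V.card < U.card := Finset.card_lt_card <|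
        Finset.ssubset_iff_subset_ne.mpr ⟨hVU, fun e => by simp [e] at h0⟩
      refine ⟨insert j V, Finset.insert_subset hjU.1 hVU, ?_, fun k hk i hi => ?_⟩
      · rw [Finset.card_insert_of_notMem hjU.2]
        omega
      · have hk' : k ∈ U \ V := by
          simp only [Finset.mem_sdiff, Finset.mem_insert, not_or] at hk ⊢
          exact ⟨hk.1, hk.2.2⟩
        rcases Finset.mem_insert.mp hi with rfl | hi
        · exact hmax k hk'
        · exact hV k hk' i hi

lemma sqNorm_restrictTo (U : Finset (Fin m)) (h : Fin m → ℝ) :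
    sqNorm (restrictTo U h) = ∑ i ∈ U, h i ^ 2 := by
  simp [sqNorm, restrictTo, ite_pow, Finset.sum_ite_mem]

lemma restrictTo_add_of_disjoint {U V : Finset (Fin m)} (hd : Disjoint U V) (h : Fin m → ℝ) :
    restrictTo (U ∪ V) h = restrictTo U h + restrictTo V h := by
  ext i
  by_cases h1 : i ∈ U
  · have h2 : i ∉ V := Finset.disjoint_left.mp hd h1
    simp [restrictTo, h1, h2]
  · simp [restrictTo, h1]

/-- Cutting `h` on `U` into blocks of `S` entries of decreasing size bounds its correlation with
a `2 S`-sparse vector supported elsewhere. -/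
lemma abs_dotProduct_restrictTo_le (A : Matrix (Fin n) (Fin m) ℝ) {S : ℕ} (hS : 0 < S)
    (h : Fin m → ℝ) {W : Finset (Fin m)} (hW : W.card ≤ 2 * S) {v : Fin m → ℝ}
    (hv : SupportedOn W v) (U : Finset (Fin m)) : Disjoint U W → ∀ M : ℝ, 0 ≤ M →
      (∀ i ∈ U, |h i| ≤ M) →
      |(A *ᵥ restrictTo U h) ⬝ᵥ (A *ᵥ v)| ≤
        ropConst A S (2 * S) * √(sqNorm v) * (√S * M + (∑ i ∈ U, |h i|) / √S) := by
  have hθ := (ropConst_mem A S (2 * S)).1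
  have hs : (0 : ℝ) < √S := Real.sqrt_pos.mpr (by exact_mod_cast hS)
  have hss : √(S : ℝ) * √S = S := Real.mul_self_sqrt (by positivity)
  induction U using Finset.strongInduction with
  | H U ih =>
  intro hd M hM hUM
  rcases U.eq_empty_or_nonempty with rfl | hne
  · have : restrictTo ∅ h = 0 := by ext i; simp [restrictTo]
    simp only [this, Matrix.mulVec_zero, zero_dotProduct, abs_zero, Finset.sum_empty, zero_div,
      add_zero]
    positivity
  obtain ⟨V, hVU, hVc, hV⟩ := exists_largest h U S
  have hVS : V.card ≤ S := hVc.trans_le (min_le_left _ _)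
  have hVpos : 0 < V.card := by rw [hVc]; exact lt_min hS hne.card_pos
  have hss' : U \ V ⊂ U := Finset.sdiff_ssubset hVU (Finset.card_pos.mp hVpos)
  have hVsum : 0 ≤ ∑ i ∈ V, |h i| := Finset.sum_nonneg fun _ _ => abs_nonneg _
  have hS0 : (0 : ℝ) < S := by exact_mod_cast hS
  have h2 := ih _ hss' (Finset.disjoint_of_subset_left Finset.sdiff_subset hd)
    ((∑ i ∈ V, |h i|) / S) (by positivity)
    (fun j hj => by rw [le_div_iff₀ hS0, mul_comm]; exact hV j hj)
  have h1 := (ropConst_mem A S (2 * S)).2 V W hVS hW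
    (Finset.disjoint_of_subset_left hVU hd) _ _ (supportedOn_restrictTo V h) hv
  have h3 : √(sqNorm (restrictTo V h)) ≤ √S * M := by
    rw [sqNorm_restrictTo]
    refine Real.sqrt_le_iff.mpr ⟨by positivity, ?_⟩
    calc ∑ i ∈ V, h i ^ 2 ≤ ∑ i ∈ V, M ^ 2 := Finset.sum_le_sum fun i hi => by
          rw [← sq_abs]; exact pow_le_pow_left₀ (abs_nonneg _) (hUM i (hVU hi)) 2
      _ = V.card * M ^ 2 := by simp
      _ ≤ S * M ^ 2 := by gcongr
      _ = (√S * M) ^ 2 := by rw [mul_pow, sq (√(S : ℝ)), hss]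
  have hsplit : restrictTo U h = restrictTo V h + restrictTo (U \ V) h := by
    rw [← restrictTo_add_of_disjoint Finset.disjoint_sdiff, Finset.union_sdiff_of_subset hVU]
  have hsum : ∑ i ∈ U, |h i| = ∑ i ∈ U \ V, |h i| + ∑ i ∈ V, |h i| :=
    (Finset.sum_sdiff hVU).symm
  have hdiv : √S * ((∑ i ∈ V, |h i|) / S) = (∑ i ∈ V, |h i|) / √S := by
    rw [eq_div_iff hs.ne', mul_right_comm, hss, mul_div_cancel₀ _ hS0.ne']
  rw [hsplit, Matrix.mulVec_add, add_dotProduct]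
  refine (abs_add_le _ _).trans ((add_le_add h1 h2).trans ?_)
  rw [hdiv, hsum]
  have := mul_le_mul_of_nonneg_left h3 (mul_nonneg hθ (Real.sqrt_nonneg (sqNorm v)))
  calc _ = ropConst A S (2 * S) * √(sqNorm v) * √(sqNorm (restrictTo V h)) +
        ropConst A S (2 * S) * √(sqNorm v) * ((∑ i ∈ V, |h i|) / √S +
          (∑ i ∈ U \ V, |h i|) / √S) := by ring
    _ ≤ ropConst A S (2 * S) * √(sqNorm v) * (√S * M) +
        ropConst A S (2 * S) * √(sqNorm v) * ((∑ i ∈ V, |h i|) / √S +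
          (∑ i ∈ U \ V, |h i|) / √S) := by gcongr
    _ = _ := by ring

lemma sum_abs_le_sqrt (U : Finset (Fin m)) (h : Fin m → ℝ) :
    ∑ i ∈ U, |h i| ≤ √U.card * √(∑ i ∈ U, h i ^ 2) := by
  rw [← Real.sqrt_mul (by positivity)]
  refine Real.le_sqrt_of_sq_le ?_
  simpa using sq_sum_le_card_mul_sum_sq (s := U) (f := fun i => |h i|)

/-- The Candès–Tao estimate: a vector `h` in the cone `‖h_{T₀ᶜ}‖₁ ≤ ‖h_{T₀}‖₁` for which `A' A h`
is small is itself small. -/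
lemma sqNorm_le_of_cone (A : Matrix (Fin n) (Fin m) ℝ) {S : ℕ}
    (hA : ripConst A (2 * S) + ropConst A S (2 * S) < 1) {T₀ : Finset (Fin m)}
    (hT₀ : T₀.card ≤ S) {ρ : ℝ} (hρ : 0 ≤ ρ) {h : Fin m → ℝ}
    (hcone : ∑ i ∈ T₀ᶜ, |h i| ≤ ∑ i ∈ T₀, |h i|)
    (hcorr : ∀ i, |(Aᵀ *ᵥ (A *ᵥ h)) i| ≤ 2 * ρ) :
    sqNorm h ≤ dantzigC1 A S ^ 2 * ρ ^ 2 * S := by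
  rcases Nat.eq_zero_or_pos S with rfl | hS
  · have hT : T₀ = ∅ := by simpa using hT₀
    subst hT
    have h0 : ∀ i, h i = 0 := by
      have hz : ∑ i, |h i| = 0 :=
        le_antisymm (by simpa using hcone) (Finset.sum_nonneg fun _ _ => abs_nonneg _)
      intro i
      simpa using (Finset.sum_eq_zero_iff_of_nonneg (fun _ _ => abs_nonneg _)).mp hz i
        (Finset.mem_univ i)
    simp [sqNorm, h0]
  obtain ⟨T₁, hT₁, hc₁, hmax⟩ := exists_largest h T₀ᶜ S
  have hS0 : (0 : ℝ) < S := by exact_mod_cast hS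
  have hs : (0 : ℝ) < √S := Real.sqrt_pos.mpr hS0
  have hss : √(S : ℝ) ^ 2 = S := Real.sq_sqrt (by positivity)
  have hd01 : Disjoint T₀ T₁ := (Finset.subset_compl_iff_disjoint_left.mp hT₁)
  set W := T₀ ∪ T₁ with hWdef
  have hWc : W.card ≤ 2 * S := (Finset.card_union_le _ _).trans (by omega)
  set R := T₀ᶜ \ T₁ with hR
  have hRW : Wᶜ = R := by ext i; simp [W, R]
  set L := ∑ i ∈ T₀ᶜ, |h i|
  set a := √(sqNorm (restrictTo W h))
  have ha2 : a ^ 2 = sqNorm (restrictTo W h) := Real.sq_sqrt (sqNorm_nonneg _)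
  have ha0 : 0 ≤ a := Real.sqrt_nonneg _
  set δ := ripConst A (2 * S)
  set θ := ropConst A S (2 * S)
  have hθ : 0 ≤ θ := (ropConst_mem A S (2 * S)).1
  have hL1 : ∑ i ∈ T₁, |h i| + ∑ i ∈ R, |h i| = L := by
    rw [add_comm]; exact Finset.sum_sdiff hT₁
  have hLR : 0 ≤ ∑ i ∈ R, |h i| := Finset.sum_nonneg fun _ _ => abs_nonneg _
  have hL1' : 0 ≤ ∑ i ∈ T₁, |h i| := Finset.sum_nonneg fun _ _ => abs_nonneg _
  have hL0 : 0 ≤ L := by linarith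
  have hLa : L ≤ √S * a := by
    refine hcone.trans ((sum_abs_le_sqrt T₀ h).trans ?_)
    refine mul_le_mul (Real.sqrt_le_sqrt (by exact_mod_cast hT₀)) (Real.sqrt_le_sqrt ?_)
      (Real.sqrt_nonneg _) hs.le
    rw [sqNorm_restrictTo]
    exact Finset.sum_le_sum_of_subset_of_nonneg Finset.subset_union_left
      fun _ _ _ => sq_nonneg _
  have hsplit : h = restrictTo W h + restrictTo R h := by
    rw [← hRW, ← restrictTo_add_of_disjoint disjoint_compl_right, Finset.union_compl]
    ext i; simp [restrictTo]
  have hRsmall : ∀ i ∈ R, |h i| ≤ (∑ i ∈ T₁, |h i|) / S := fun i hi => by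
    rw [le_div_iff₀ hS0, mul_comm]; exact hmax i hi
  have hcross := abs_dotProduct_restrictTo_le A hS h hWc (supportedOn_restrictTo W h) R
    (by rw [← hRW]; exact disjoint_compl_left) _ (by positivity) hRsmall
  have hcross' : |(A *ᵥ restrictTo R h) ⬝ᵥ (A *ᵥ restrictTo W h)| ≤ θ * a * a := by
    refine hcross.trans ?_
    have : √S * ((∑ i ∈ T₁, |h i|) / S) + (∑ i ∈ R, |h i|) / √S = L / √S := by
      rw [← hL1, add_div, add_left_inj]
      nth_rewrite 2 [← hss]
      field_simp
    rw [this]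
    exact mul_le_mul_of_nonneg_left ((div_le_iff₀' hs).mpr hLa) (by positivity)
  have hcorr' : |(A *ᵥ restrictTo W h) ⬝ᵥ (A *ᵥ h)| ≤ √(2 * S) * a * (2 * ρ) := by
    have e : (A *ᵥ restrictTo W h) ⬝ᵥ (A *ᵥ h) = ∑ i ∈ W, h i * (Aᵀ *ᵥ (A *ᵥ h)) i := by
      rw [Matrix.mulVec_transpose, dotProduct_comm, Matrix.dotProduct_mulVec, dotProduct_comm]
      simp [dotProduct, restrictTo, Finset.sum_ite_mem]
    rw [e]
    calc _ ≤ ∑ i ∈ W, |h i| * (2 * ρ) := (Finset.abs_sum_le_sum_abs _ _).trans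
          (Finset.sum_le_sum fun i _ => by
            rw [abs_mul]; exact mul_le_mul_of_nonneg_left (hcorr i) (abs_nonneg _))
      _ = (∑ i ∈ W, |h i|) * (2 * ρ) := by rw [Finset.sum_mul]
      _ ≤ _ := by
        refine mul_le_mul_of_nonneg_right ((sum_abs_le_sqrt W h).trans ?_) (by positivity)
        rw [← sqNorm_restrictTo]
        exact mul_le_mul_of_nonneg_right (Real.sqrt_le_sqrt (by exact_mod_cast hWc)) ha0
  have hlow : (1 - δ) * a ^ 2 ≤ √(2 * S) * a * (2 * ρ) + θ * a * a := by
    have h1 := ripConst_lower A hWc (supportedOn_restrictTo W h)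
    have h2 : sqNorm (A *ᵥ restrictTo W h) = (A *ᵥ restrictTo W h) ⬝ᵥ (A *ᵥ h) -
        (A *ᵥ restrictTo R h) ⬝ᵥ (A *ᵥ restrictTo W h) := by
      nth_rewrite 3 [hsplit]
      rw [Matrix.mulVec_add, dotProduct_add, ← sqNorm_eq_dotProduct,
        dotProduct_comm (A *ᵥ restrictTo R h)]
      ring
    rw [← ha2, h2] at h1
    linarith [abs_le.mp hcross', abs_le.mp hcorr']
  have hgap : 0 < 1 - δ - θ := by linarith
  have ha_le : (1 - δ - θ) * a ≤ √(2 * S) * (2 * ρ) := by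
    rcases ha0.eq_or_lt with h0 | h0
    · rw [← h0]; simp only [mul_zero]; positivity
    · refine le_of_mul_le_mul_left ?_ h0
      nlinarith
  have hrest : sqNorm (restrictTo R h) ≤ a ^ 2 := by
    have h1 : sqNorm (restrictTo R h) ≤ (∑ i ∈ T₁, |h i|) / S * ∑ i ∈ R, |h i| := by
      rw [sqNorm_restrictTo, Finset.mul_sum]
      refine Finset.sum_le_sum fun i hi => ?_
      rw [← sq_abs, sq]
      exact mul_le_mul_of_nonneg_right (hRsmall i hi) (abs_nonneg _)
    have h2 : (∑ i ∈ T₁, |h i|) / S * ∑ i ∈ R, |h i| ≤ L ^ 2 / S := by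
      rw [div_mul_eq_mul_div]
      refine div_le_div_of_nonneg_right ?_ hS0.le
      nlinarith
    have h3 : L ^ 2 / S ≤ a ^ 2 := by
      rw [div_le_iff₀ hS0]
      calc L ^ 2 ≤ (√S * a) ^ 2 := pow_le_pow_left₀ hL0 hLa 2
        _ = a ^ 2 * S := by rw [mul_pow, hss]; ring
    linarith
  have htot : sqNorm h = a ^ 2 + sqNorm (restrictTo R h) := by
    rw [ha2, sqNorm_restrictTo, sqNorm_restrictTo, ← hRW, Finset.sum_add_sum_compl]; rfl
  have hC : dantzigC1 A S ^ 2 * ρ ^ 2 * S = 16 * S * ρ ^ 2 / (1 - δ - θ) ^ 2 := by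
    rw [dantzigC1, div_pow]; ring
  rw [hC, le_div_iff₀ (by positivity)]
  have hsq : ((1 - δ - θ) * a) ^ 2 ≤ (√(2 * S) * (2 * ρ)) ^ 2 :=
    pow_le_pow_left₀ (by positivity) ha_le 2
  rw [mul_pow, mul_pow, Real.sq_sqrt (show (0 : ℝ) ≤ 2 * S by positivity)] at hsq
  have hle : sqNorm h ≤ 2 * a ^ 2 := by linarith
  have := mul_le_mul_of_nonneg_right hle (sq_nonneg (1 - δ - θ))
  linarith

/-- The error bound for the Dantzig selector, when the true sparse vector is feasible. -/
lemma IsDantzigSelector.sqNorm_sub_le {A : Matrix (Fin n) (Fin m) ℝ} {S : ℕ}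
    (hA : ripConst A (2 * S) + ropConst A S (2 * S) < 1) {ρ : ℝ} (hρ : 0 ≤ ρ)
    {r : Fin n → ℝ} {βhat β : Fin m → ℝ} (hβhat : IsDantzigSelector A ρ r βhat)
    (hβ : DSFeasible A ρ r β) {T₀ : Finset (Fin m)} (hT₀ : T₀.card ≤ S)
    (hsupp : SupportedOn T₀ β) :
    sqNorm (βhat - β) ≤ dantzigC1 A S ^ 2 * ρ ^ 2 * S := by
  refine sqNorm_le_of_cone A hA hT₀ hρ ?_ fun i => ?_
  · have h1 := hβhat.2 β hβ
    rw [← Finset.sum_add_sum_compl T₀ (fun i => |βhat i|),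
      ← Finset.sum_add_sum_compl T₀ (fun i => |β i|)] at h1
    have h2 : ∑ i ∈ T₀ᶜ, |β i| = 0 := Finset.sum_eq_zero fun i hi => by
      simp [hsupp i (Finset.mem_compl.mp hi)]
    have h3 : ∑ i ∈ T₀ᶜ, |(βhat - β) i| = ∑ i ∈ T₀ᶜ, |βhat i| :=
      Finset.sum_congr rfl fun i hi => by simp [hsupp i (Finset.mem_compl.mp hi)]
    have h4 : ∑ i ∈ T₀, |β i| ≤ ∑ i ∈ T₀, |βhat i| + ∑ i ∈ T₀, |(βhat - β) i| := by
      rw [← Finset.sum_add_distrib]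
      refine Finset.sum_le_sum fun i _ => ?_
      have := abs_sub_abs_le_abs_sub (β i) (βhat i)
      rw [abs_sub_comm] at this
      simp only [Pi.sub_apply]
      linarith
    linarith
  · have e : Aᵀ *ᵥ (A *ᵥ (βhat - β)) =
        Aᵀ *ᵥ (r - A *ᵥ β) - Aᵀ *ᵥ (r - A *ᵥ βhat) := by
      rw [← Matrix.mulVec_sub, Matrix.mulVec_sub A]
      congr 1
      abel
    rw [e, Pi.sub_apply]
    have h1 := abs_le.mp (hβ i)
    have h2 := abs_le.mp (hβhat.1 i)
    rw [abs_le]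
    constructor <;> linarith

/-! ### Matrices supported on a set of coordinates -/

/-- The `m × m` coordinate projection `I_N`: the identity on `N × N` and zero elsewhere. -/
def proj (N : Finset (Fin m)) : Matrix (Fin m) (Fin m) ℝ :=
  Matrix.diagonal fun i => if i ∈ N then 1 else 0

lemma mulVec_dotProduct {ι κ : Type*} [Fintype ι] [Fintype κ] (M : Matrix ι κ ℝ) (v : κ → ℝ)
    (w : ι → ℝ) : (M *ᵥ v) ⬝ᵥ w = v ⬝ᵥ (Mᵀ *ᵥ w) := by
  rw [Matrix.mulVec_transpose, dotProduct_comm, Matrix.dotProduct_mulVec, dotProduct_comm]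

/-- The inclusion of the coordinates in `T`, an `m × |T|` matrix; `A_T = A * incl T`. -/
def incl (T : Finset (Fin m)) : Matrix (Fin m) T ℝ :=
  (1 : Matrix (Fin m) (Fin m) ℝ).submatrix id Subtype.val

lemma proj_mulVec (N : Finset (Fin m)) (v : Fin m → ℝ) : proj N *ᵥ v = restrictTo N v := by
  ext i
  simp [proj, Matrix.mulVec_diagonal, restrictTo]

lemma supportedOn_iff {N : Finset (Fin m)} {v : Fin m → ℝ} :
    SupportedOn N v ↔ proj N *ᵥ v = v := by
  rw [proj_mulVec, funext_iff]
  refine forall_congr' fun i => ?_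
  by_cases h : i ∈ N <;> simp [restrictTo, h, eq_comm]

lemma proj_transpose (N : Finset (Fin m)) : (proj N)ᵀ = proj N := Matrix.diagonal_transpose _

lemma proj_mul_proj (N : Finset (Fin m)) : proj N * proj N = proj N := by
  simp [proj, Matrix.diagonal_mul_diagonal]

lemma proj_mul_of_subset {T N : Finset (Fin m)} (h : T ⊆ N) : proj N * proj T = proj T := by
  rw [proj, proj, Matrix.diagonal_mul_diagonal]
  congr 1
  ext i
  by_cases hi : i ∈ T
  · simp [hi, h hi]
  · simp [hi]

lemma diagOn_eq (σ : ℝ) (T : Finset (Fin m)) : diagOn σ T = σ ^ 2 • proj T := by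
  rw [diagOn, proj, ← Matrix.diagonal_smul]
  congr 1
  ext i
  simp

lemma proj_mul_incl (T : Finset (Fin m)) : proj T * incl T = incl T := by
  ext i j
  simp only [proj, Matrix.diagonal_mul, incl, Matrix.submatrix_apply, id, Matrix.one_apply]
  by_cases h : i = j
  · simp [h, j.2]
  · simp [h]

lemma mul_incl (A : Matrix (Fin n) (Fin m) ℝ) (T : Finset (Fin m)) : A * incl T = colSub A T := by
  ext i j
  simp [incl, colSub, Matrix.mul_apply, Matrix.one_apply]

lemma incl_mul_apply {κ : Type*} (T : Finset (Fin m)) (M : Matrix T κ ℝ) (i : Fin m) (j : κ) :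
    (incl T * M) i j = if h : i ∈ T then M ⟨i, h⟩ j else 0 := by
  rw [Matrix.mul_apply]
  split_ifs with h
  · rw [Finset.sum_eq_single ⟨i, h⟩]
    · simp [incl, Matrix.one_apply]
    · intro b _ hb
      have : i ≠ b := fun e => hb (Subtype.ext e.symm)
      simp [incl, this]
    · simp
  · refine Finset.sum_eq_zero fun b _ => ?_
    have : i ≠ b := fun e => h (e ▸ b.2)
    simp [incl, this]

lemma incl_mulVec_apply (T : Finset (Fin m)) (v : T → ℝ) (i : Fin m) :
    (incl T *ᵥ v) i = if h : i ∈ T then v ⟨i, h⟩ else 0 := by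
  have := incl_mul_apply T (Matrix.replicateCol Unit v) i ()
  simpa [Matrix.mul_apply, Matrix.mulVec, dotProduct] using this

lemma incl_mul_transpose (T : Finset (Fin m)) : incl T * (incl T)ᵀ = proj T := by
  ext i j
  rw [incl_mul_apply]
  by_cases h : i ∈ T
  · by_cases hij : i = j
    · subst hij; simp [h, incl, proj, Matrix.one_apply]
    · simp [h, incl, proj, hij, Ne.symm hij]
  · by_cases hij : i = j
    · subst hij; simp [h, proj]
    · simp [h, proj, hij]

/-! ### Least squares -/

/-- The columns of `A` in `N` are linearly independent. -/
def InjOn (A : Matrix (Fin n) (Fin m) ℝ) (N : Finset (Fin m)) : Prop :=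
  ∀ c, SupportedOn N c → A *ᵥ c = 0 → c = 0

lemma InjOn.mono {A : Matrix (Fin n) (Fin m) ℝ} {T N : Finset (Fin m)} (h : T ⊆ N)
    (hN : InjOn A N) : InjOn A T := fun c hc => hN c (hc.mono h)

lemma injOn_of_ripConst_lt {A : Matrix (Fin n) (Fin m) ℝ} {S : ℕ} (h : ripConst A S < 1)
    {T : Finset (Fin m)} (hT : T.card ≤ S) : InjOn A T := fun c hc h0 => by
  have := ripConst_lower A hT hc
  rw [h0, sqNorm_eq_zero.mpr rfl] at this
  exact sqNorm_eq_zero.mp <|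
    le_antisymm (nonpos_of_mul_nonpos_right this (by linarith)) (sqNorm_nonneg c)

/-- The Gram matrix `A_T' A_T`. -/
def gram (A : Matrix (Fin n) (Fin m) ℝ) (T : Finset (Fin m)) : Matrix T T ℝ :=
  (colSub A T)ᵀ * colSub A T

/-- The pseudo-inverse `(A_T' A_T)⁻¹ A_T'`, with zero rows off `T`. -/
noncomputable def lsMat (A : Matrix (Fin n) (Fin m) ℝ) (T : Finset (Fin m)) :
    Matrix (Fin m) (Fin n) ℝ :=
  incl T * (gram A T)⁻¹ * (colSub A T)ᵀ

lemma lsEst_eq (A : Matrix (Fin n) (Fin m) ℝ) (T : Finset (Fin m)) (y : Fin n → ℝ) :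
    lsEst A T y = lsMat A T *ᵥ y := by
  rw [lsMat, Matrix.mul_assoc, ← Matrix.mulVec_mulVec, ← Matrix.mulVec_mulVec]
  ext i
  rw [incl_mulVec_apply]
  rfl

lemma lsCov_eq (A : Matrix (Fin n) (Fin m) ℝ) (σ : ℝ) (T : Finset (Fin m)) :
    lsCov A σ T = σ ^ 2 • (incl T * (gram A T)⁻¹ * (incl T)ᵀ) := by
  ext i j
  rw [Matrix.smul_apply, Matrix.mul_assoc, incl_mul_apply, smul_eq_mul, lsCov, Matrix.of_apply]
  by_cases hi : i ∈ T
  · have : ((gram A T)⁻¹ * (incl T)ᵀ) ⟨i, hi⟩ j =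
        if hj : j ∈ T then (gram A T)⁻¹ᵀ ⟨j, hj⟩ ⟨i, hi⟩ else 0 := by
      rw [← incl_mul_apply, ← Matrix.transpose_apply (incl T * _), Matrix.transpose_mul,
        Matrix.transpose_transpose]
    by_cases hj : j ∈ T
    · simp only [hi, hj, and_self, dite_true, this, Matrix.transpose_apply]
      exact mul_comm _ _
    · simp [hi, hj, this]
  · simp [hi]

lemma gram_posDef {A : Matrix (Fin n) (Fin m) ℝ} {T : Finset (Fin m)} (h : InjOn A T) :
    (gram A T).PosDef := by
  have := Matrix.PosDef.conjTranspose_mul_self (colSub A T) ?_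
  · simpa [gram, Matrix.conjTranspose_eq_transpose_of_trivial] using this
  · rw [← Matrix.coe_mulVecLin, injective_iff_map_eq_zero]
    intro v hv
    rw [Matrix.mulVecLin_apply, ← mul_incl, ← Matrix.mulVec_mulVec] at hv
    have h0 := h (incl T *ᵥ v) (supportedOn_iff.mpr (by
      rw [Matrix.mulVec_mulVec, proj_mul_incl])) hv
    ext i
    have := congrFun h0 i
    rw [incl_mulVec_apply] at this
    simpa using this

lemma gram_inv_mul {A : Matrix (Fin n) (Fin m) ℝ} {T : Finset (Fin m)} (h : InjOn A T) :
    (gram A T)⁻¹ * gram A T = 1 :=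
  Matrix.nonsing_inv_mul _ (gram_posDef h).det_pos.ne'.isUnit

lemma gram_transpose (A : Matrix (Fin n) (Fin m) ℝ) (T : Finset (Fin m)) :
    (gram A T)ᵀ = gram A T := by
  simp [gram, Matrix.transpose_mul]

lemma proj_mul_lsMat (A : Matrix (Fin n) (Fin m) ℝ) (T : Finset (Fin m)) :
    proj T * lsMat A T = lsMat A T := by
  simp only [lsMat, ← Matrix.mul_assoc, proj_mul_incl]

/-- Least squares is a left inverse of `A` on the vectors supported on `T`. -/
lemma lsMat_mul_mul_proj {A : Matrix (Fin n) (Fin m) ℝ} {T : Finset (Fin m)} (h : InjOn A T) :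
    lsMat A T * A * proj T = proj T := by
  rw [← incl_mul_transpose, ← Matrix.mul_assoc, lsMat, Matrix.mul_assoc _ A, mul_incl,
    Matrix.mul_assoc _ (colSub A T)ᵀ, ← gram, Matrix.mul_assoc _ (gram A T)⁻¹, gram_inv_mul h,
    Matrix.mul_one]

lemma mul_lsMat (A : Matrix (Fin n) (Fin m) ℝ) (T : Finset (Fin m)) :
    A * lsMat A T = colSub A T * (gram A T)⁻¹ * (colSub A T)ᵀ := by
  simp only [lsMat, ← Matrix.mul_assoc, mul_incl]

lemma mul_lsMat_transpose (A : Matrix (Fin n) (Fin m) ℝ) (T : Finset (Fin m)) :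
    (A * lsMat A T)ᵀ = A * lsMat A T := by
  rw [mul_lsMat]
  simp only [Matrix.transpose_mul, Matrix.transpose_transpose, Matrix.transpose_nonsing_inv,
    gram_transpose, Matrix.mul_assoc]

/-- `A_T (A_T' A_T)⁻¹ A_T'` is the orthogonal projection onto the span of the columns in `T`. -/
lemma mul_lsMat_mul_self {A : Matrix (Fin n) (Fin m) ℝ} {T : Finset (Fin m)} (h : InjOn A T) :
    A * lsMat A T * (A * lsMat A T) = A * lsMat A T := by
  have : lsMat A T * (A * lsMat A T) = lsMat A T := by
    nth_rewrite 2 [← proj_mul_lsMat]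
    rw [← Matrix.mul_assoc, ← Matrix.mul_assoc, lsMat_mul_mul_proj h, proj_mul_lsMat]
  rw [Matrix.mul_assoc, this]

lemma sqNorm_mulVec_lsEst_le {A : Matrix (Fin n) (Fin m) ℝ} {T : Finset (Fin m)} (h : InjOn A T)
    (y : Fin n → ℝ) : sqNorm (A *ᵥ lsEst A T y) ≤ sqNorm y := by
  rw [lsEst_eq, Matrix.mulVec_mulVec]
  set M := A * lsMat A T with hM
  have h1 : (M *ᵥ y) ⬝ᵥ (y - M *ᵥ y) = 0 := by
    rw [mulVec_dotProduct, mul_lsMat_transpose, Matrix.mulVec_sub, Matrix.mulVec_mulVec,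
      mul_lsMat_mul_self h, sub_self, dotProduct_zero]
  have h2 := sqNorm_add (M *ᵥ y) (y - M *ᵥ y)
  rw [h1, add_sub_cancel] at h2
  linarith [sqNorm_nonneg (y - M *ᵥ y)]

/-! ### The Kalman update -/

/-- What holds of every posterior covariance `P` of a Kalman filter or of least squares on `N`:
`P` is positive semidefinite, supported on `N × N`, and `A P A' ≤ σ² I`. -/
structure IsPosterior (A : Matrix (Fin n) (Fin m) ℝ) (σ : ℝ) (N : Finset (Fin m))
    (P : Matrix (Fin m) (Fin m) ℝ) : Prop where
  posSemidef : P.PosSemidef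
  proj_mul : proj N * P = P
  bound : (σ ^ 2 • (1 : Matrix (Fin n) (Fin n) ℝ) - A * P * Aᵀ).PosSemidef

lemma PosSemidef.transpose_eq {ι : Type*} {P : Matrix ι ι ℝ} (h : P.PosSemidef) : Pᵀ = P := by
  have := h.isHermitian
  rwa [Matrix.IsHermitian, Matrix.conjTranspose_eq_transpose_of_trivial] at this

lemma IsPosterior.mul_proj {A : Matrix (Fin n) (Fin m) ℝ} {σ : ℝ} {N : Finset (Fin m)}
    {P : Matrix (Fin m) (Fin m) ℝ} (h : IsPosterior A σ N P) : P * proj N = P := by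
  have := congrArg Matrix.transpose h.proj_mul
  rwa [Matrix.transpose_mul, proj_transpose, PosSemidef.transpose_eq h.posSemidef] at this

lemma IsPosterior.mono {A : Matrix (Fin n) (Fin m) ℝ} {σ : ℝ} {T N : Finset (Fin m)}
    {P : Matrix (Fin m) (Fin m) ℝ} (hTN : T ⊆ N) (h : IsPosterior A σ T P) :
    IsPosterior A σ N P :=
  ⟨h.posSemidef, by rw [← h.proj_mul, ← Matrix.mul_assoc, proj_mul_of_subset hTN], h.bound⟩

lemma isPosterior_zero (A : Matrix (Fin n) (Fin m) ℝ) (σ : ℝ) (N : Finset (Fin m)) :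
    IsPosterior A σ N 0 := by
  refine ⟨Matrix.PosSemidef.zero, by simp, ?_⟩
  simpa using Matrix.PosSemidef.one.smul (sq_nonneg σ)

lemma posSemidef_transpose_mul_self {ι κ : Type*} [Fintype ι] [Fintype κ] (M : Matrix ι κ ℝ) :
    (Mᵀ * M).PosSemidef := by
  simpa [Matrix.conjTranspose_eq_transpose_of_trivial] using
    Matrix.posSemidef_conjTranspose_mul_self M

lemma PosSemidef.mul_mul_transpose {ι κ : Type*} [Fintype ι] [Fintype κ] {P : Matrix ι ι ℝ}
    (h : P.PosSemidef) (M : Matrix κ ι ℝ) : (M * P * Mᵀ).PosSemidef := by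
  simpa [Matrix.conjTranspose_eq_transpose_of_trivial] using h.mul_mul_conjTranspose_same M

lemma PosSemidef.dotProduct_mulVec_nonneg {ι : Type*} [Fintype ι] {P : Matrix ι ι ℝ}
    (h : P.PosSemidef) (v : ι → ℝ) : 0 ≤ v ⬝ᵥ (P *ᵥ v) := by
  simpa using h.dotProduct_mulVec_nonneg v

lemma isPosterior_lsCov {A : Matrix (Fin n) (Fin m) ℝ} (σ : ℝ) {T : Finset (Fin m)}
    (h : InjOn A T) : IsPosterior A σ T (lsCov A σ T) := by
  have hG : (gram A T)⁻¹.PosSemidef := (gram_posDef h).posSemidef.inv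
  refine ⟨?_, ?_, ?_⟩
  · rw [lsCov_eq]
    exact (PosSemidef.mul_mul_transpose hG _).smul (sq_nonneg σ)
  · rw [lsCov_eq, Matrix.mul_smul, ← Matrix.mul_assoc, ← Matrix.mul_assoc, proj_mul_incl]
  · have e : A * lsCov A σ T * Aᵀ = σ ^ 2 • (A * lsMat A T) := by
      rw [lsCov_eq, mul_lsMat, Matrix.mul_smul, Matrix.smul_mul, ← mul_incl]
      simp only [Matrix.transpose_mul, Matrix.mul_assoc]
    rw [e, ← smul_sub]
    refine Matrix.PosSemidef.smul ?_ (sq_nonneg σ)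
    have := posSemidef_transpose_mul_self (1 - A * lsMat A T)
    rwa [Matrix.transpose_sub, Matrix.transpose_one, mul_lsMat_transpose, Matrix.mul_sub,
      Matrix.sub_mul, Matrix.sub_mul, Matrix.one_mul, Matrix.one_mul, Matrix.mul_one,
      mul_lsMat_mul_self h, sub_self, sub_zero] at this

section Kalman

variable {A : Matrix (Fin n) (Fin m) ℝ} {σ : ℝ} {P : Matrix (Fin m) (Fin m) ℝ}

lemma innovCov_posDef (hσ : 0 < σ) (hP : P.PosSemidef) : (innovCov A σ P).PosDef :=
  Matrix.PosDef.posSemidef_add (PosSemidef.mul_mul_transpose hP A)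
    (Matrix.PosDef.one.smul (by positivity))

lemma innovCov_mul_inv (hσ : 0 < σ) (hP : P.PosSemidef) :
    innovCov A σ P * (innovCov A σ P)⁻¹ = 1 :=
  Matrix.mul_nonsing_inv _ (innovCov_posDef hσ hP).det_pos.ne'.isUnit

lemma innovCov_inv_mul (hσ : 0 < σ) (hP : P.PosSemidef) :
    (innovCov A σ P)⁻¹ * innovCov A σ P = 1 :=
  Matrix.nonsing_inv_mul _ (innovCov_posDef hσ hP).det_pos.ne'.isUnit

lemma innovCov_inv_transpose (hσ : 0 < σ) (hP : P.PosSemidef) :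
    (innovCov A σ P)⁻¹ᵀ = (innovCov A σ P)⁻¹ := by
  rw [Matrix.transpose_nonsing_inv, PosSemidef.transpose_eq (innovCov_posDef hσ hP).posSemidef]

/-- `A K = I - σ² Σ⁻¹`. -/
lemma mul_gain (hσ : 0 < σ) (hP : P.PosSemidef) :
    A * gain A σ P = 1 - σ ^ 2 • (innovCov A σ P)⁻¹ := by
  have h : A * P * Aᵀ = innovCov A σ P - σ ^ 2 • (1 : Matrix (Fin n) (Fin n) ℝ) := by
    rw [innovCov, add_sub_cancel_right]
  rw [gain, ← Matrix.mul_assoc, ← Matrix.mul_assoc, h, Matrix.sub_mul, innovCov_mul_inv hσ hP,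
    Matrix.smul_mul, Matrix.one_mul]

lemma one_sub_mul_gain (hσ : 0 < σ) (hP : P.PosSemidef) :
    1 - A * gain A σ P = σ ^ 2 • (innovCov A σ P)⁻¹ := by
  rw [mul_gain hσ hP, sub_sub_cancel]

/-- `P⁺ A' = σ² K`: the gain in terms of the updated covariance. -/
lemma kfCov_mul_transpose (hσ : 0 < σ) (hP : P.PosSemidef) :
    kfCov A σ P * Aᵀ = σ ^ 2 • gain A σ P := by
  have h : A * P * Aᵀ = innovCov A σ P - σ ^ 2 • (1 : Matrix (Fin n) (Fin n) ℝ) := by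
    rw [innovCov, add_sub_cancel_right]
  have h2 : gain A σ P * (A * P * Aᵀ) = P * Aᵀ - σ ^ 2 • gain A σ P := by
    rw [h, Matrix.mul_sub, Matrix.mul_smul, Matrix.mul_one, gain, Matrix.mul_assoc (P * Aᵀ),
      innovCov_inv_mul hσ hP, Matrix.mul_one]
  rw [kfCov, Matrix.sub_mul, Matrix.sub_mul, Matrix.one_mul]
  simp only [Matrix.mul_assoc] at h2 ⊢
  rw [h2, sub_sub_cancel]

lemma kfCov_transpose (hσ : 0 < σ) (hP : P.PosSemidef) : (kfCov A σ P)ᵀ = kfCov A σ P := by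
  rw [kfCov, gain, Matrix.sub_mul, Matrix.one_mul]
  simp only [Matrix.transpose_sub, Matrix.transpose_mul, Matrix.transpose_transpose,
    innovCov_inv_transpose hσ hP, PosSemidef.transpose_eq hP, Matrix.mul_assoc]

/-- The covariance update as a congruence, plus the contribution of the observation noise. -/
lemma kfCov_joseph (hσ : 0 < σ) (hP : P.PosSemidef) :
    kfCov A σ P = (1 - gain A σ P * A) * P * (1 - gain A σ P * A)ᵀ +
      σ ^ 2 • (gain A σ P * (gain A σ P)ᵀ) := by
  have h : (1 - gain A σ P * A) * P = kfCov A σ P := rfl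
  rw [h, Matrix.transpose_sub, Matrix.transpose_one, Matrix.transpose_mul, Matrix.mul_sub,
    Matrix.mul_one, ← Matrix.mul_assoc, kfCov_mul_transpose hσ hP, Matrix.smul_mul,
    sub_add_cancel]

lemma kfCov_posSemidef (hσ : 0 < σ) (hP : P.PosSemidef) : (kfCov A σ P).PosSemidef := by
  rw [kfCov_joseph hσ hP]
  refine (PosSemidef.mul_mul_transpose hP _).add (Matrix.PosSemidef.smul ?_ (sq_nonneg σ))
  simpa using posSemidef_transpose_mul_self (gain A σ P)ᵀ

lemma proj_mul_gain {N : Finset (Fin m)} (h : proj N * P = P) :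
    proj N * gain A σ P = gain A σ P := by
  simp only [gain, ← Matrix.mul_assoc, h]

lemma isPosterior_kfCov (hσ : 0 < σ) (hP : P.PosSemidef) {N : Finset (Fin m)}
    (h : proj N * P = P) : IsPosterior A σ N (kfCov A σ P) := by
  refine ⟨kfCov_posSemidef hσ hP, ?_, ?_⟩
  · rw [kfCov, Matrix.sub_mul, Matrix.one_mul, Matrix.mul_sub, h, ← Matrix.mul_assoc,
      ← Matrix.mul_assoc, proj_mul_gain h]
  · rw [Matrix.mul_assoc, kfCov_mul_transpose hσ hP, Matrix.mul_smul, ← smul_sub,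
      one_sub_mul_gain hσ hP, smul_smul]
    exact (innovCov_posDef hσ hP).posSemidef.inv.smul (by positivity)

/-- The difference of two updated covariances is a congruence-like image of the difference of
the predicted ones. -/
lemma kfCov_sub_kfCov (hσ : 0 < σ) (hP : P.PosSemidef) {P' : Matrix (Fin m) (Fin m) ℝ}
    (hP' : P'.PosSemidef) :
    kfCov A σ P - kfCov A σ P' =
      (1 - gain A σ P * A) * (P - P') * (1 - gain A σ P' * A)ᵀ := by
  have h : (1 - gain A σ P * A) * P = kfCov A σ P := rfl
  have h' : P' * (1 - gain A σ P' * A)ᵀ = kfCov A σ P' := by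
    rw [← kfCov_transpose hσ hP', kfCov, Matrix.transpose_mul, PosSemidef.transpose_eq hP']
  rw [Matrix.mul_sub, Matrix.sub_mul, h, Matrix.mul_assoc _ P', h', Matrix.transpose_sub,
    Matrix.transpose_one, Matrix.transpose_mul, Matrix.mul_sub, Matrix.mul_one,
    ← Matrix.mul_assoc, kfCov_mul_transpose hσ hP, Matrix.smul_mul, Matrix.sub_mul,
    Matrix.one_mul, Matrix.mul_assoc (gain A σ P) A]
  have h2 : A * kfCov A σ P' = σ ^ 2 • (gain A σ P')ᵀ := by
    rw [← kfCov_transpose hσ hP', ← Matrix.transpose_transpose A, ← Matrix.transpose_mul,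
      Matrix.transpose_transpose, kfCov_mul_transpose hσ hP', Matrix.transpose_smul]
  rw [h2, Matrix.mul_smul]
  abel

/-- `Σ_fe = σ⁴ Σ⁻¹`, so its inverse is at least `σ⁻² I`. -/
lemma sqNorm_kfResidual_le (hσ : 0 < σ) (hP : P.PosSemidef) (x : Fin m → ℝ) (y : Fin n → ℝ) :
    sqNorm (kfResidual A σ P x y) ≤ σ ^ 2 * kfFEN A σ P x y := by
  have hσ4 : σ ^ 2 * σ ^ 2 ≠ 0 := by positivity
  have h1 : filtErrCov A σ P = (σ ^ 2 * σ ^ 2) • (innovCov A σ P)⁻¹ := by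
    rw [filtErrCov, one_sub_mul_gain hσ hP, Matrix.transpose_smul, innovCov_inv_transpose hσ hP,
      Matrix.smul_mul, Matrix.smul_mul, Matrix.mul_smul, innovCov_inv_mul hσ hP, Matrix.one_mul,
      smul_smul]
  have h2 : (filtErrCov A σ P)⁻¹ = (σ ^ 2 * σ ^ 2)⁻¹ • innovCov A σ P := by
    refine Matrix.inv_eq_left_inv ?_
    rw [h1, Matrix.smul_mul, Matrix.mul_smul, smul_smul, inv_mul_cancel₀ hσ4, one_smul,
      innovCov_mul_inv hσ hP]
  rw [kfFEN, h2, sqNorm_eq_dotProduct]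
  set r := kfResidual A σ P x y
  have h3 := PosSemidef.dotProduct_mulVec_nonneg (PosSemidef.mul_mul_transpose hP A) r
  rw [Matrix.smul_mulVec, dotProduct_smul, innovCov, Matrix.add_mulVec, Matrix.smul_mulVec,
    Matrix.one_mulVec, dotProduct_add, dotProduct_smul, smul_eq_mul, smul_eq_mul]
  have h4 : σ ^ 2 * ((σ ^ 2 * σ ^ 2)⁻¹ * (r ⬝ᵥ (A * P * Aᵀ) *ᵥ r + σ ^ 2 * (r ⬝ᵥ r))) =
      r ⬝ᵥ r + (σ ^ 2)⁻¹ * (r ⬝ᵥ (A * P * Aᵀ) *ᵥ r) := by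
    field_simp
    ring
  rw [h4]
  have : 0 ≤ (σ ^ 2)⁻¹ * (r ⬝ᵥ (A * P * Aᵀ) *ᵥ r) := by positivity
  linarith

/-- Both `σ² Σ⁻¹` and `A K = I - σ² Σ⁻¹` are contractions. -/
lemma sqNorm_mul_gain_le (hσ : 0 < σ) (hP : P.PosSemidef) (v : Fin n → ℝ) :
    sqNorm ((1 - A * gain A σ P) *ᵥ v) ≤ sqNorm v ∧ sqNorm ((A * gain A σ P) *ᵥ v) ≤ sqNorm v := by
  set u := (1 - A * gain A σ P) *ᵥ v with hu
  set z := (A * gain A σ P) *ᵥ v with hz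
  have huz : u + z = v := by
    rw [hu, hz, ← Matrix.add_mulVec, sub_add_cancel, Matrix.one_mulVec]
  have hSu : innovCov A σ P *ᵥ u = σ ^ 2 • v := by
    rw [hu, one_sub_mul_gain hσ hP, Matrix.smul_mulVec, Matrix.mulVec_smul, Matrix.mulVec_mulVec,
      innovCov_mul_inv hσ hP, Matrix.one_mulVec]
  rw [innovCov, Matrix.add_mulVec, Matrix.smul_mulVec, Matrix.one_mulVec, ← huz, smul_add,
    add_comm, add_right_inj] at hSu
  have hcross : 0 ≤ u ⬝ᵥ z := by
    have h := PosSemidef.dotProduct_mulVec_nonneg (PosSemidef.mul_mul_transpose hP A) u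
    rw [hSu, dotProduct_smul, smul_eq_mul] at h
    exact nonneg_of_mul_nonneg_right h (by positivity)
  have := sqNorm_add u z
  rw [huz] at this
  constructor <;> linarith [sqNorm_nonneg u, sqNorm_nonneg z]

end Kalman

/-! ### Exponential stability of the Kalman filter on a fixed support -/

/-- The Euclidean norm of a vector. -/
noncomputable def nrm {ι : Type*} [Fintype ι] (v : ι → ℝ) : ℝ := √(sqNorm v)

section nrm

variable {ι κ : Type*} [Fintype ι] [Fintype κ]

lemma nrm_nonneg (v : ι → ℝ) : 0 ≤ nrm v := Real.sqrt_nonneg _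

lemma nrm_sq (v : ι → ℝ) : nrm v ^ 2 = sqNorm v := Real.sq_sqrt (sqNorm_nonneg v)

lemma nrm_le_nrm {v : ι → ℝ} {w : κ → ℝ} (h : sqNorm v ≤ sqNorm w) : nrm v ≤ nrm w :=
  Real.sqrt_le_sqrt h

lemma nrm_le_mul {v : ι → ℝ} {w : κ → ℝ} {c : ℝ} (hc : 0 ≤ c)
    (h : sqNorm v ≤ c ^ 2 * sqNorm w) : nrm v ≤ c * nrm w := by
  refine Real.sqrt_le_iff.mpr ⟨mul_nonneg hc (nrm_nonneg _), ?_⟩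
  rwa [mul_pow, nrm_sq]

@[simp] lemma nrm_zero : nrm (0 : ι → ℝ) = 0 := by simp [nrm, sqNorm]

lemma nrm_smul (a : ℝ) (v : ι → ℝ) : nrm (a • v) = |a| * nrm v := by
  rw [nrm, sqNorm_smul, Real.sqrt_mul (sq_nonneg a), Real.sqrt_sq_eq_abs, nrm]

lemma nrm_add_le (v w : ι → ℝ) : nrm (v + w) ≤ nrm v + nrm w := by
  have h : v ⬝ᵥ w ≤ nrm v * nrm w := by
    refine le_of_sq_le_sq ?_ (mul_nonneg (nrm_nonneg _) (nrm_nonneg _))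
    rw [mul_pow, nrm_sq, nrm_sq]
    exact dotProduct_sq_le v w
  refine Real.sqrt_le_iff.mpr ⟨add_nonneg (nrm_nonneg _) (nrm_nonneg _), ?_⟩
  rw [sqNorm_add, ← nrm_sq v, ← nrm_sq w]
  linarith

lemma nrm_sub_le (v w : ι → ℝ) : nrm (v - w) ≤ nrm v + nrm w := by
  have := nrm_add_le v ((-1 : ℝ) • w)
  rw [nrm_smul, abs_neg, abs_one, one_mul] at this
  simpa [sub_eq_add_neg] using this

lemma nrm_sum_le {α : Type*} (s : Finset α) (f : α → ι → ℝ) :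
    nrm (∑ a ∈ s, f a) ≤ ∑ a ∈ s, nrm (f a) :=
  Finset.le_sum_of_subadditive nrm nrm_zero.le nrm_add_le s f

lemma norm_le_nrm (v : ι → ℝ) : ‖v‖ ≤ nrm v :=
  (pi_norm_le_iff_of_nonneg (nrm_nonneg v)).mpr fun i => by
    rw [Real.norm_eq_abs, ← Real.sqrt_sq_eq_abs]
    exact Real.sqrt_le_sqrt (sq_le_sqNorm v i)

lemma nrm_le_sum_abs (v : ι → ℝ) : nrm v ≤ ∑ i, |v i| := by
  refine Real.sqrt_le_iff.mpr ⟨Finset.sum_nonneg fun _ _ => abs_nonneg _, ?_⟩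
  simpa [sqNorm] using
    Finset.sum_sq_le_sq_sum_of_nonneg (s := Finset.univ) (f := fun i => |v i|)
      (fun _ _ => abs_nonneg _)

lemma exists_nrm_mulVec_le (M : Matrix ι κ ℝ) : ∃ a, 0 ≤ a ∧ ∀ v, nrm (M *ᵥ v) ≤ a * nrm v := by
  have h0 : 0 ≤ ∑ i, sqNorm (M i) := Finset.sum_nonneg fun _ _ => sqNorm_nonneg _
  refine ⟨√(∑ i, sqNorm (M i)), Real.sqrt_nonneg _, fun v => nrm_le_mul (Real.sqrt_nonneg _) ?_⟩
  rw [Real.sq_sqrt h0]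
  exact sqNorm_mulVec_le M v

/-- A matrix and its transpose have the same operator norm. -/
lemma sqNorm_mulVec_le_of_transpose {M : Matrix ι κ ℝ} {K : ℝ} (hK : 0 ≤ K)
    (h : ∀ v, sqNorm (Mᵀ *ᵥ v) ≤ K * sqNorm v) (v : κ → ℝ) :
    sqNorm (M *ᵥ v) ≤ K * sqNorm v := by
  set u := M *ᵥ v with hu
  have h1 : sqNorm u * sqNorm u ≤ K * sqNorm v * sqNorm u := by
    have h2 : sqNorm u = v ⬝ᵥ (Mᵀ *ᵥ u) := by
      rw [sqNorm_eq_dotProduct]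
      nth_rewrite 1 [hu]
      rw [mulVec_dotProduct]
    calc sqNorm u * sqNorm u = (v ⬝ᵥ (Mᵀ *ᵥ u)) ^ 2 := by rw [← h2, sq]
      _ ≤ sqNorm v * sqNorm (Mᵀ *ᵥ u) := dotProduct_sq_le _ _
      _ ≤ sqNorm v * (K * sqNorm u) := mul_le_mul_of_nonneg_left (h u) (sqNorm_nonneg v)
      _ = _ := by ring
  rcases (sqNorm_nonneg u).eq_or_lt with h0 | h0
  · rw [← h0]
    exact mul_nonneg hK (sqNorm_nonneg v)
  · exact le_of_mul_le_mul_right h1 h0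

lemma proj_nrm_le {N : Finset (Fin m)} (v : Fin m → ℝ) : nrm (proj N *ᵥ v) ≤ nrm v := by
  refine nrm_le_nrm ?_
  rw [proj_mulVec, sqNorm_restrictTo, sqNorm]
  exact Finset.sum_le_sum_of_subset_of_nonneg (Finset.subset_univ _) fun _ _ _ => sq_nonneg _

end nrm

section Stability

variable {A : Matrix (Fin n) (Fin m) ℝ} {σ : ℝ} {N : Finset (Fin m)}

lemma IsPosterior.pred_posSemidef {P : Matrix (Fin m) (Fin m) ℝ} (h : IsPosterior A σ N P)
    (q : ℝ) (T : Finset (Fin m)) : (P + diagOn q T).PosSemidef := by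
  refine h.posSemidef.add ?_
  rw [diagOn_eq]
  refine Matrix.PosSemidef.smul ?_ (sq_nonneg q)
  have := posSemidef_transpose_mul_self (proj T)
  rwa [proj_transpose, proj_mul_proj] at this

lemma IsPosterior.proj_mul_pred {P : Matrix (Fin m) (Fin m) ℝ} (h : IsPosterior A σ N P)
    (q : ℝ) {T : Finset (Fin m)} (hT : T ⊆ N) :
    proj N * (P + diagOn q T) = P + diagOn q T := by
  rw [Matrix.mul_add, h.proj_mul, diagOn_eq, Matrix.mul_smul, proj_mul_of_subset hT]

lemma IsPosterior.kfCov {P : Matrix (Fin m) (Fin m) ℝ} (hσ : 0 < σ) (h : IsPosterior A σ N P)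
    (q : ℝ) {T : Finset (Fin m)} (hT : T ⊆ N) :
    IsPosterior A σ N (kfCov A σ (P + diagOn q T)) :=
  isPosterior_kfCov hσ (h.pred_posSemidef q T) (h.proj_mul_pred q hT)

/-- Since `A` has a left inverse on `N`, the bound `A P A' ≤ σ² I` bounds `P` itself. -/
lemma exists_dotProduct_mulVec_le (hA : InjOn A N) (σ : ℝ) :
    ∃ c, 0 < c ∧ ∀ P, IsPosterior A σ N P → ∀ v, v ⬝ᵥ (P *ᵥ v) ≤ c * sqNorm (proj N *ᵥ v) := by
  set L := lsMat A N
  have hs : 0 ≤ ∑ i, sqNorm (Lᵀ i) := Finset.sum_nonneg fun _ _ => sqNorm_nonneg _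
  refine ⟨σ ^ 2 * (∑ i, sqNorm (Lᵀ i)) + 1, by positivity, fun P hP v => ?_⟩
  have h1 : L * A * P = P := by
    rw [← hP.proj_mul, ← Matrix.mul_assoc, lsMat_mul_mul_proj hA]
  have h2 : P = L * (A * P * Aᵀ) * Lᵀ := by
    have := congrArg Matrix.transpose h1
    rw [Matrix.transpose_mul, Matrix.transpose_mul, PosSemidef.transpose_eq hP.posSemidef] at this
    calc P = L * A * P := h1.symm
      _ = L * A * (P * (Aᵀ * Lᵀ)) := by rw [this]
      _ = _ := by simp only [Matrix.mul_assoc]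
  have h3 : Lᵀ *ᵥ v = Lᵀ *ᵥ (proj N *ᵥ v) := by
    have := congrArg Matrix.transpose (proj_mul_lsMat A N)
    rw [Matrix.transpose_mul, proj_transpose] at this
    rw [Matrix.mulVec_mulVec, this]
  have h4 := PosSemidef.dotProduct_mulVec_nonneg hP.bound (Lᵀ *ᵥ v)
  rw [Matrix.sub_mulVec, Matrix.smul_mulVec, Matrix.one_mulVec, dotProduct_sub, dotProduct_smul,
    ← sqNorm_eq_dotProduct, smul_eq_mul] at h4
  have h5 : v ⬝ᵥ (P *ᵥ v) = (Lᵀ *ᵥ v) ⬝ᵥ ((A * P * Aᵀ) *ᵥ (Lᵀ *ᵥ v)) := by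
    rw [mulVec_dotProduct, Matrix.transpose_transpose, Matrix.mulVec_mulVec, Matrix.mulVec_mulVec,
      ← h2]
  have h6 := sqNorm_mulVec_le Lᵀ (proj N *ᵥ v)
  rw [← h3] at h6
  have h7 := mul_le_mul_of_nonneg_left h6 (sq_nonneg σ)
  rw [h5]
  nlinarith [sqNorm_nonneg (proj N *ᵥ v)]

/-- A bound for the quadratic form of a positive semidefinite matrix bounds its operator norm. -/
lemma PosSemidef.nrm_mulVec_le {P : Matrix (Fin m) (Fin m) ℝ} (hP : P.PosSemidef) {c : ℝ}
    (hc : 0 < c) (h : ∀ v, v ⬝ᵥ (P *ᵥ v) ≤ c * sqNorm v) (v : Fin m → ℝ) :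
    nrm (P *ᵥ v) ≤ c * nrm v := by
  -- The vector `c v - P v` is the optimal test vector for the positivity of `P`.
  have h1 := PosSemidef.dotProduct_mulVec_nonneg hP (c • v - P *ᵥ v)
  have h2 : v ⬝ᵥ (P *ᵥ (P *ᵥ v)) = sqNorm (P *ᵥ v) := by
    rw [sqNorm_eq_dotProduct, mulVec_dotProduct, PosSemidef.transpose_eq hP]
  rw [Matrix.mulVec_sub, Matrix.mulVec_smul, sub_dotProduct, dotProduct_sub, dotProduct_sub,
    smul_dotProduct, smul_dotProduct, dotProduct_smul, dotProduct_smul, h2,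
    ← sqNorm_eq_dotProduct] at h1
  simp only [smul_eq_mul] at h1
  have h3 : c * sqNorm (P *ᵥ v) ≤ c * (c ^ 2 * sqNorm v) := by
    nlinarith [h (P *ᵥ v), mul_le_mul_of_nonneg_left (h v) (sq_nonneg c)]
  exact nrm_le_mul hc.le (le_of_mul_le_mul_left h3 hc)

/-- The transition matrix `(I - K_t A) ⋯ (I - K_1 A)` of the Kalman filter with predicted
covariances `Pp 0, Pp 1, …`. -/
noncomputable def trans (A : Matrix (Fin n) (Fin m) ℝ) (σ : ℝ)
    (Pp : ℕ → Matrix (Fin m) (Fin m) ℝ) : ℕ → Matrix (Fin m) (Fin m) ℝ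
  | 0 => 1
  | t + 1 => (1 - gain A σ (Pp t) * A) * trans A σ Pp t

/-- The posterior covariances `P` follow the Riccati recursion on the fixed support `N`. -/
structure IsRiccati (A : Matrix (Fin n) (Fin m) ℝ) (q σ : ℝ) (N : Finset (Fin m))
    (P : ℕ → Matrix (Fin m) (Fin m) ℝ) : Prop where
  zero : IsPosterior A σ N (P 0)
  succ : ∀ t, P (t + 1) = KFCS.kfCov A σ (P t + diagOn q N)

lemma IsRiccati.isPosterior {q : ℝ} (hσ : 0 < σ) {P : ℕ → Matrix (Fin m) (Fin m) ℝ}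
    (h : IsRiccati A q σ N P) (t : ℕ) : IsPosterior A σ N (P t) := by
  induction t with
  | zero => exact h.zero
  | succ t ih => rw [h.succ]; exact ih.kfCov hσ q subset_rfl

lemma sqNorm_proj (v : Fin m → ℝ) : sqNorm (proj N *ᵥ v) = v ⬝ᵥ (proj N *ᵥ v) := by
  rw [sqNorm_eq_dotProduct, mulVec_dotProduct, proj_transpose, Matrix.mulVec_mulVec, proj_mul_proj]

/-- The predicted covariance dominates the transition matrix, with a factor that grows
geometrically because each prediction step inflates the covariance by `1 + q² / c` or more. -/
lemma IsRiccati.mul_sqNorm_trans_le {q c : ℝ} (hσ : 0 < σ) (hc : 0 < c)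
    (hbound : ∀ P, IsPosterior A σ N P → ∀ v, v ⬝ᵥ (P *ᵥ v) ≤ c * sqNorm (proj N *ᵥ v))
    {P : ℕ → Matrix (Fin m) (Fin m) ℝ} (h : IsRiccati A q σ N P) (t : ℕ) (v : Fin m → ℝ) :
    (1 + q ^ 2 / c) ^ t * (q ^ 2 * sqNorm (proj N *ᵥ
      ((trans A σ (fun t => P t + diagOn q N) t)ᵀ *ᵥ v))) ≤
      v ⬝ᵥ ((P t + diagOn q N) *ᵥ v) := by
  have hdiag : ∀ (Q : Matrix (Fin m) (Fin m) ℝ) (v : Fin m → ℝ),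
      v ⬝ᵥ ((Q + diagOn q N) *ᵥ v) = v ⬝ᵥ (Q *ᵥ v) + q ^ 2 * sqNorm (proj N *ᵥ v) := fun Q v => by
    rw [Matrix.add_mulVec, dotProduct_add, diagOn_eq, Matrix.smul_mulVec, dotProduct_smul,
      sqNorm_proj, smul_eq_mul]
  induction t generalizing v with
  | zero =>
    rw [hdiag]
    simp only [pow_zero, one_mul, trans, Matrix.transpose_one, Matrix.one_mulVec]
    linarith [PosSemidef.dotProduct_mulVec_nonneg h.zero.posSemidef v]
  | succ t ih =>
    set Φ := 1 - gain A σ (P t + diagOn q N) * A with hΦ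
    have hpsd := (h.isPosterior hσ t).pred_posSemidef q N
    have h1 := ih (Φᵀ *ᵥ v)
    have h2 : (Φᵀ *ᵥ v) ⬝ᵥ ((P t + diagOn q N) *ᵥ (Φᵀ *ᵥ v)) ≤ v ⬝ᵥ (P (t + 1) *ᵥ v) := by
      rw [h.succ, kfCov_joseph hσ hpsd, ← hΦ, Matrix.add_mulVec (Φ * _ * _), dotProduct_add,
        mulVec_dotProduct, Matrix.transpose_transpose, Matrix.mulVec_mulVec, Matrix.mulVec_mulVec,
        le_add_iff_nonneg_right, Matrix.smul_mulVec, dotProduct_smul]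
      refine mul_nonneg (sq_nonneg σ) ?_
      have := posSemidef_transpose_mul_self (gain A σ (P t + diagOn q N))ᵀ
      rw [Matrix.transpose_transpose] at this
      exact PosSemidef.dotProduct_mulVec_nonneg this v
    have h3 : (1 + q ^ 2 / c) * (v ⬝ᵥ (P (t + 1) *ᵥ v)) ≤
        v ⬝ᵥ ((P (t + 1) + diagOn q N) *ᵥ v) := by
      rw [hdiag, add_mul, one_mul, add_le_add_iff_left, div_mul_eq_mul_div, div_le_iff₀ hc,
        mul_assoc, mul_comm _ c]
      exact mul_le_mul_of_nonneg_left (hbound _ (h.isPosterior hσ _) v) (sq_nonneg q)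
    have h4 : (trans A σ (fun t => P t + diagOn q N) (t + 1))ᵀ *ᵥ v =
        (trans A σ (fun t => P t + diagOn q N) t)ᵀ *ᵥ (Φᵀ *ᵥ v) := by
      rw [trans, Matrix.transpose_mul, Matrix.mulVec_mulVec]
    rw [h4, pow_succ', mul_assoc]
    exact (mul_le_mul_of_nonneg_left (h1.trans h2) (by positivity)).trans h3

/-- The Kalman filter on a fixed support on which `A` is injective is exponentially stable,
uniformly in its initial covariance. -/
lemma exists_trans_bound {q : ℝ} (hA : InjOn A N) (hσ : 0 < σ) (hq : 0 < q) :
    ∃ C r : ℝ, 0 ≤ C ∧ 0 ≤ r ∧ r < 1 ∧ ∀ P, IsRiccati A q σ N P → ∀ (t : ℕ) (v : Fin m → ℝ),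
      nrm (trans A σ (fun t => P t + diagOn q N) t *ᵥ (proj N *ᵥ v)) ≤ C * r ^ t * nrm v ∧
      nrm (proj N *ᵥ ((trans A σ (fun t => P t + diagOn q N) t)ᵀ *ᵥ v)) ≤ C * r ^ t * nrm v := by
  obtain ⟨c, hc, hbound⟩ := exists_dotProduct_mulVec_le hA σ
  have hq2 : 0 < q ^ 2 := by positivity
  set κ := 1 + q ^ 2 / c with hκ
  have hκ1 : 1 < κ := by have := div_pos hq2 hc; linarith
  have hκ0 : 0 < κ := by linarith
  refine ⟨√((c + q ^ 2) / q ^ 2), √(κ⁻¹), Real.sqrt_nonneg _, Real.sqrt_nonneg _, ?_, ?_⟩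
  · rw [Real.sqrt_lt' one_pos, one_pow]
    exact inv_lt_one_of_one_lt₀ hκ1
  intro P hP t
  set Φ := trans A σ (fun t => P t + diagOn q N) t
  have hsq : (√((c + q ^ 2) / q ^ 2) * √(κ⁻¹) ^ t) ^ 2 = (c + q ^ 2) / q ^ 2 * κ⁻¹ ^ t := by
    rw [mul_pow, ← pow_mul, mul_comm t 2, pow_mul, Real.sq_sqrt (by positivity),
      Real.sq_sqrt (by positivity)]
  have h1 : ∀ v, sqNorm ((Φ * proj N)ᵀ *ᵥ v) ≤ (c + q ^ 2) / q ^ 2 * κ⁻¹ ^ t * sqNorm v := by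
    intro v
    have h2 := hP.mul_sqNorm_trans_le hσ hc hbound t v
    have h3 := hbound _ (hP.isPosterior hσ t) v
    have h4 : sqNorm (proj N *ᵥ v) ≤ sqNorm v := by
      rw [← nrm_sq, ← nrm_sq]; exact pow_le_pow_left₀ (nrm_nonneg _) (proj_nrm_le v) 2
    rw [Matrix.add_mulVec, dotProduct_add, diagOn_eq, Matrix.smul_mulVec, dotProduct_smul,
      ← sqNorm_proj, smul_eq_mul, ← diagOn_eq, ← hκ] at h2
    rw [Matrix.transpose_mul, proj_transpose, ← Matrix.mulVec_mulVec]
    set s := sqNorm (proj N *ᵥ (Φᵀ *ᵥ v))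
    have h5 : κ ^ t * (q ^ 2 * s) ≤ (c + q ^ 2) * sqNorm v := by nlinarith
    have h6 : 0 < κ ^ t := by positivity
    rw [inv_pow]
    calc s = (κ ^ t * (q ^ 2 * s)) / (q ^ 2 * κ ^ t) := by field_simp
      _ ≤ ((c + q ^ 2) * sqNorm v) / (q ^ 2 * κ ^ t) := by gcongr
      _ = _ := by field_simp
  have hK : 0 ≤ (c + q ^ 2) / q ^ 2 * κ⁻¹ ^ t := by positivity
  intro v
  constructor <;> refine nrm_le_mul (by positivity) ?_ <;> rw [hsq]
  · rw [Matrix.mulVec_mulVec]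
    exact sqNorm_mulVec_le_of_transpose hK h1 v
  · have := h1 v
    rwa [Matrix.transpose_mul, proj_transpose, ← Matrix.mulVec_mulVec] at this

/-- The difference of two solutions of the Riccati recursion. -/
lemma IsRiccati.sub_eq {q : ℝ} (hσ : 0 < σ) {P P' : ℕ → Matrix (Fin m) (Fin m) ℝ}
    (h : IsRiccati A q σ N P) (h' : IsRiccati A q σ N P') (t : ℕ) :
    P t - P' t = trans A σ (fun t => P t + diagOn q N) t * (P 0 - P' 0) *
      (trans A σ (fun t => P' t + diagOn q N) t)ᵀ := by
  induction t with
  | zero => simp [trans]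
  | succ t ih =>
    rw [h.succ, h'.succ, kfCov_sub_kfCov hσ ((h.isPosterior hσ t).pred_posSemidef q N)
      ((h'.isPosterior hσ t).pred_posSemidef q N), add_sub_add_right_eq_sub, ih]
    simp only [trans, Matrix.transpose_mul, Matrix.mul_assoc]

/-- The difference of two Kalman filters with the same data is the image under the transition
matrix of the first of a vector that depends on the innovations of the second. -/
lemma IsRiccati.kf_sub_eq {q : ℝ} (hσ : 0 < σ) {P P' : ℕ → Matrix (Fin m) (Fin m) ℝ}
    (h : IsRiccati A q σ N P) (h' : IsRiccati A q σ N P') {x x' : ℕ → Fin m → ℝ}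
    {y : ℕ → Fin n → ℝ} (hx : ∀ t, x (t + 1) = kfState A σ (P t + diagOn q N) (x t) (y t))
    (hx' : ∀ t, x' (t + 1) = kfState A σ (P' t + diagOn q N) (x' t) (y t)) (t : ℕ) :
    x t - x' t = trans A σ (fun t => P t + diagOn q N) t *ᵥ ((x 0 - x' 0) + (P 0 - P' 0) *ᵥ
      ∑ k ∈ Finset.range t, (σ ^ 2)⁻¹ • ((trans A σ (fun t => P' t + diagOn q N) (k + 1))ᵀ *ᵥ
        (Aᵀ *ᵥ (y k - A *ᵥ x' k)))) := by
  induction t with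
  | zero => simp [trans]
  | succ t ih =>
    set K := gain A σ (P t + diagOn q N) with hK
    set K' := gain A σ (P' t + diagOn q N) with hK'
    have h1 : x (t + 1) - x' (t + 1) =
        (1 - K * A) *ᵥ (x t - x' t) + (K - K') *ᵥ (y t - A *ᵥ x' t) := by
      rw [hx, hx', kfState, kfState, ← hK, ← hK']
      simp only [Matrix.sub_mulVec, Matrix.mulVec_sub, Matrix.one_mulVec, Matrix.mulVec_mulVec,
        Matrix.sub_mul]
      abel
    have h2 : K - K' = (σ ^ 2)⁻¹ • ((P (t + 1) - P' (t + 1)) * Aᵀ) := by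
      rw [Matrix.sub_mul, h.succ, h'.succ,
        kfCov_mul_transpose hσ ((h.isPosterior hσ t).pred_posSemidef q N),
        kfCov_mul_transpose hσ ((h'.isPosterior hσ t).pred_posSemidef q N), ← smul_sub, smul_smul,
        inv_mul_cancel₀ (by positivity), one_smul]
    rw [h1, ih, h2, h.sub_eq hσ h' (t + 1), Finset.sum_range_succ]
    have h3 : trans A σ (fun t => P t + diagOn q N) (t + 1) =
      (1 - K * A) * trans A σ (fun t => P t + diagOn q N) t := rfl
    rw [h3]
    simp only [Matrix.mulVec_add, Matrix.mulVec_smul, Matrix.smul_mulVec, Matrix.mulVec_mulVec,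
      Matrix.mul_assoc, add_assoc]

/-- Two Kalman filters on the same support and with the same data forget their different initial
conditions exponentially fast. -/
lemma exists_kf_sub_bound {q : ℝ} (hA : InjOn A N) (hσ : 0 < σ) (hq : 0 < q) :
    ∃ C r : ℝ, 0 ≤ C ∧ 0 ≤ r ∧ r < 1 ∧
      ∀ (P P' : ℕ → Matrix (Fin m) (Fin m) ℝ) (x x' : ℕ → Fin m → ℝ) (y : ℕ → Fin n → ℝ)
        (t : ℕ) (B : ℝ), IsRiccati A q σ N P → IsRiccati A q σ N P' →
        (∀ t, x (t + 1) = kfState A σ (P t + diagOn q N) (x t) (y t)) →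
        (∀ t, x' (t + 1) = kfState A σ (P' t + diagOn q N) (x' t) (y t)) →
        SupportedOn N (x 0) → SupportedOn N (x' 0) → 0 ≤ B → nrm (x 0) ≤ B → nrm (x' 0) ≤ B →
        (∀ k < t, nrm (x' k) ≤ B) → (∀ k < t, nrm (y k) ≤ B) →
        nrm (x t - x' t) ≤ C * r ^ t * (t + 1) * B := by
  obtain ⟨C, r, hC, hr, hr1, htrans⟩ := exists_trans_bound hA hσ hq
  obtain ⟨c, hc, hbound⟩ := exists_dotProduct_mulVec_le hA σ
  obtain ⟨a, ha, hAa⟩ := exists_nrm_mulVec_le A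
  obtain ⟨b, hb, hAb⟩ := exists_nrm_mulVec_le Aᵀ
  set G := (σ ^ 2)⁻¹ * (C * (b * (1 + a))) with hG
  have hG0 : 0 ≤ G := by positivity
  refine ⟨C * (2 + 2 * c * G), r, by positivity, hr, hr1, ?_⟩
  intro P P' x x' y t B hP hP' hx hx' hs hs' hB hx0 hx0' hxB hyB
  have hop : ∀ Q, IsPosterior A σ N Q → ∀ v, nrm (Q *ᵥ v) ≤ c * nrm v := fun Q hQ =>
    PosSemidef.nrm_mulVec_le hQ.posSemidef hc fun v => (hbound Q hQ v).trans <|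
      mul_le_mul_of_nonneg_left (by
        rw [← nrm_sq, ← nrm_sq]; exact pow_le_pow_left₀ (nrm_nonneg _) (proj_nrm_le v) 2) hc.le
  set g := ∑ k ∈ Finset.range t, (σ ^ 2)⁻¹ • ((trans A σ (fun t => P' t + diagOn q N) (k + 1))ᵀ *ᵥ
        (Aᵀ *ᵥ (y k - A *ᵥ x' k))) with hg
  have hgB : nrm (proj N *ᵥ g) ≤ t * (G * B) := by
    rw [hg, Matrix.mulVec_sum]
    refine (nrm_sum_le _ _).trans ?_
    have : (t : ℝ) * (G * B) = ∑ k ∈ Finset.range t, G * B := by simp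
    rw [this]
    refine Finset.sum_le_sum fun k hk => ?_
    have hkt := Finset.mem_range.mp hk
    rw [Matrix.mulVec_smul, nrm_smul, abs_of_nonneg (by positivity), hG, mul_assoc]
    refine mul_le_mul_of_nonneg_left ?_ (by positivity)
    refine ((htrans P' hP' (k + 1) _).2).trans ?_
    have h1 : nrm (y k - A *ᵥ x' k) ≤ (1 + a) * B := by
      refine (nrm_sub_le _ _).trans ?_
      nlinarith [hyB k hkt, hAa (x' k), mul_le_mul_of_nonneg_left (hxB k hkt) ha]
    have h2 : nrm (Aᵀ *ᵥ (y k - A *ᵥ x' k)) ≤ b * ((1 + a) * B) :=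
      (hAb _).trans (mul_le_mul_of_nonneg_left h1 hb)
    have h3 : C * r ^ (k + 1) ≤ C := mul_le_of_le_one_right hC (pow_le_one₀ hr hr1.le)
    calc _ ≤ C * (b * ((1 + a) * B)) :=
          mul_le_mul h3 h2 (nrm_nonneg _) hC
      _ = _ := by ring
  have hD : nrm ((P 0 - P' 0) *ᵥ (proj N *ᵥ g)) ≤ 2 * c * (t * (G * B)) := by
    rw [Matrix.sub_mulVec]
    refine (nrm_sub_le _ _).trans ?_
    nlinarith [hop _ hP.zero (proj N *ᵥ g), hop _ hP'.zero (proj N *ᵥ g),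
      mul_le_mul_of_nonneg_left hgB hc.le]
  have hv : (x 0 - x' 0) + (P 0 - P' 0) *ᵥ g =
      proj N *ᵥ ((x 0 - x' 0) + (P 0 - P' 0) *ᵥ (proj N *ᵥ g)) := by
    rw [Matrix.mulVec_add, supportedOn_iff.mp (hs.sub hs'), Matrix.mulVec_mulVec,
      Matrix.mulVec_mulVec, Matrix.mul_sub, Matrix.sub_mul, hP.zero.proj_mul, hP'.zero.proj_mul,
      hP.zero.mul_proj, hP'.zero.mul_proj]
  rw [hP.kf_sub_eq hσ hP' hx hx' t, ← hg, hv]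
  refine ((htrans P hP t _).1).trans ?_
  have h4 : nrm ((x 0 - x' 0) + (P 0 - P' 0) *ᵥ (proj N *ᵥ g)) ≤
      (2 + 2 * c * G) * ((t + 1) * B) := by
    refine (nrm_add_le _ _).trans ?_
    have h5 := nrm_sub_le (x 0) (x' 0)
    have h6 : (2 + 2 * c * G) * ((t + 1) * B) =
        2 * B + 2 * c * (t * (G * B)) + (2 * (t * B) + 2 * c * (G * B)) := by ring
    have h7 : 0 ≤ 2 * (t * B) + 2 * c * (G * B) := by positivity
    linarith
  calc _ ≤ C * r ^ t * ((2 + 2 * c * G) * ((t + 1) * B)) :=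
        mul_le_mul_of_nonneg_left h4 (by positivity)
    _ = _ := by ring

end Stability

/-! ### One detection step -/

section Detection

variable {A : Matrix (Fin n) (Fin m) ℝ} {σ : ℝ}

lemma colL1_le_maxColL1 (A : Matrix (Fin n) (Fin m) ℝ) (i : Fin m) :
    ∑ k, |A k i| ≤ maxColL1 A :=
  le_ciSup (f := fun i => ∑ k, |A k i|) (Set.finite_range _).bddAbove i

/-- The bound on the noise makes the true error vector feasible for the Dantzig selector. -/
lemma abs_transpose_mulVec_noise_le {ρ : ℝ} {w : Fin n → ℝ}
    (hw : ∀ k, |w k| * maxColL1 A ≤ ρ) (hρ : 0 ≤ ρ) (i : Fin m) : |(Aᵀ *ᵥ w) i| ≤ ρ := by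
  have hcol := colL1_le_maxColL1 A i
  have h0 : 0 ≤ ∑ k, |A k i| := Finset.sum_nonneg fun _ _ => abs_nonneg _
  have h1 : |(Aᵀ *ᵥ w) i| ≤ ∑ k, |A k i| * |w k| := by
    simp only [Matrix.mulVec, dotProduct, Matrix.transpose_apply]
    refine (Finset.abs_sum_le_sum_abs _ _).trans (Finset.sum_le_sum fun k _ => ?_)
    rw [abs_mul]
  refine h1.trans ?_
  rcases h0.eq_or_lt with h | h
  · have hz := (Finset.sum_eq_zero_iff_of_nonneg (fun k _ => abs_nonneg (A k i))).mp h.symm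
    rw [Finset.sum_eq_zero fun k hk => by rw [hz k hk, zero_mul]]
    exact hρ
  · have hM : 0 < maxColL1 A := h.trans_le hcol
    calc ∑ k, |A k i| * |w k| ≤ ∑ k, |A k i| * (ρ / maxColL1 A) :=
          Finset.sum_le_sum fun k _ => mul_le_mul_of_nonneg_left
            ((le_div_iff₀ hM).mpr (hw k)) (abs_nonneg _)
      _ = (∑ k, |A k i|) * (ρ / maxColL1 A) := by rw [Finset.sum_mul]
      _ ≤ maxColL1 A * (ρ / maxColL1 A) := by gcongr
      _ = ρ := mul_div_cancel₀ _ hM.ne'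

/-- The support update makes no false additions, and adds every coordinate of the true error
whose square exceeds four times the threshold. -/
lemma CSUpdate.subset_and_mem {S : ℕ} (hσ : 0 < σ)
    (hA : ripConst A (2 * S) + ropConst A S (2 * S) < 1) {T T' N : Finset (Fin m)}
    (hT : T ⊆ N) (hN : N.card ≤ S) {β : Fin m → ℝ} (hβ : SupportedOn N β) {w : Fin n → ℝ}
    (hw : ∀ k, |w k| * maxColL1 A ≤ lam m * σ)
    (h : CSUpdate A σ (threshB1 A S σ) T (A *ᵥ β + w) T') :
    T' ⊆ N ∧ T ⊆ T' ∧ ∀ i, i ∉ T → 4 * threshB1 A S σ < β i ^ 2 → i ∈ T' := by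
  obtain ⟨βhat, hβhat, rfl⟩ := h
  have hρ : 0 ≤ lam m * σ := mul_nonneg (Real.sqrt_nonneg _) hσ.le
  have hfeas : DSFeasible A (lam m * σ) (A *ᵥ β + w) β := fun i => by
    rw [add_sub_cancel_left]
    exact abs_transpose_mulVec_noise_le hw hρ i
  have herr : ∀ i, (βhat i - β i) ^ 2 ≤ threshB1 A S σ := fun i => by
    have h1 := (sq_le_sqNorm (βhat - β) i).trans (hβhat.sqNorm_sub_le hA hρ hfeas hN hβ)
    rw [threshB1]
    simp only [Pi.sub_apply] at h1
    linarith
  refine ⟨Finset.union_subset hT fun i hi => ?_, Finset.subset_union_left, fun i hiT hi => ?_⟩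
  · by_contra hiN
    have h1 := herr i
    rw [hβ i hiN, sub_zero] at h1
    exact absurd (Finset.mem_filter.mp hi).2.2 (not_lt.mpr h1)
  · refine Finset.mem_union_right _ (Finset.mem_filter.mpr ⟨Finset.mem_univ _, hiT, ?_⟩)
    -- `β² ≤ 2 βhat² + 2 (βhat - β)²`
    nlinarith [herr i, sq_nonneg (2 * βhat i - β i)]

/-- A level for the squared signal coordinates above which the detector runs the Dantzig selector
and finds the coordinate. The first term accounts for the error of the Dantzig selector; the second
makes the energy of the residual exceed `αfe σ²` in spite of the noise, whose squared norm is at most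
`n (λ_m σ / max_i ‖A_i‖₁)²`. -/
noncomputable def detectionLevel (A : Matrix (Fin n) (Fin m) ℝ) (S : ℕ) (σ αfe : ℝ) : ℝ :=
  4 * threshB1 A S σ +
    2 * (|αfe| * σ ^ 2 + n * (lam m * σ / maxColL1 A) ^ 2) / (1 - ripConst A (2 * S))

lemma threshB1_nonneg (A : Matrix (Fin n) (Fin m) ℝ) (S : ℕ) (σ : ℝ) : 0 ≤ threshB1 A S σ := by
  rw [threshB1]; positivity

lemma lt_of_detectionLevel_lt {S : ℕ} (hA : ripConst A (2 * S) < 1) {αfe z : ℝ}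
    (hz : detectionLevel A S σ αfe < z) : 4 * threshB1 A S σ < z := by
  have h1 : 0 < 1 - ripConst A (2 * S) := by linarith
  have : 0 ≤ 2 * (|αfe| * σ ^ 2 + n * (lam m * σ / maxColL1 A) ^ 2) /
    (1 - ripConst A (2 * S)) := by positivity
  rw [detectionLevel] at hz
  linarith

/-- A large coordinate of the true error makes the energy of the residual large, since the noise
is bounded. -/
lemma lt_sqNorm_residual {S : ℕ} (hA : ripConst A (2 * S) < 1)
    {N : Finset (Fin m)} (hN : N.card ≤ S) {β : Fin m → ℝ} (hβ : SupportedOn N β)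
    {w : Fin n → ℝ} (hw : ∀ k, |w k| * maxColL1 A ≤ lam m * σ) {αfe : ℝ} {i : Fin m}
    (hi : detectionLevel A S σ αfe < β i ^ 2) : αfe * σ ^ 2 < sqNorm (A *ᵥ β + w) := by
  have h1 : 0 < 1 - ripConst A (2 * S) := by linarith
  set W := (n : ℝ) * (lam m * σ / maxColL1 A) ^ 2
  have hβi : β i ≠ 0 := fun h => by
    have h2 := lt_of_detectionLevel_lt hA hi
    rw [h] at h2
    linarith [threshB1_nonneg A S σ]
  have hrip := ripConst_lower A (hN.trans (by omega : S ≤ 2 * S)) hβ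
  have hM : 0 < maxColL1 A := by
    have hsq : 0 < sqNorm (A *ᵥ β) := lt_of_lt_of_le
      (mul_pos h1 (lt_of_lt_of_le (by positivity) (sq_le_sqNorm β i))) hrip
    by_contra hM
    have hz : A = 0 := by
      ext k j
      have h3 : |A k j| ≤ ∑ k, |A k j| :=
        Finset.single_le_sum (f := fun k => |A k j|) (fun _ _ => abs_nonneg _) (Finset.mem_univ k)
      have h4 := colL1_le_maxColL1 A j
      simpa using abs_nonpos_iff.mp (h3.trans (h4.trans (not_lt.mp hM)))
    rw [hz, Matrix.zero_mulVec, sqNorm_eq_zero.mpr rfl] at hsq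
    exact lt_irrefl _ hsq
  have hW : sqNorm w ≤ W := by
    calc sqNorm w ≤ ∑ _k : Fin n, (lam m * σ / maxColL1 A) ^ 2 := by
          refine Finset.sum_le_sum fun k _ => ?_
          rw [← sq_abs]
          exact pow_le_pow_left₀ (abs_nonneg _) ((le_div_iff₀ hM).mpr (hw k)) 2
      _ = W := by simp [W]
  have h5 : 2 * (|αfe| * σ ^ 2 + W) < (1 - ripConst A (2 * S)) * β i ^ 2 := by
    rw [detectionLevel] at hi
    rw [← div_lt_iff₀' h1]
    linarith [threshB1_nonneg A S σ]
  have h6 : (1 - ripConst A (2 * S)) * β i ^ 2 ≤ sqNorm (A *ᵥ β) :=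
    (mul_le_mul_of_nonneg_left (sq_le_sqNorm β i) h1.le).trans hrip
  have h7 : sqNorm (A *ᵥ β) ≤ 2 * sqNorm (A *ᵥ β + w) + 2 * sqNorm w := by
    have e1 := sqNorm_sub (A *ᵥ β + w) w
    have e2 := sqNorm_add (A *ᵥ β + w) w
    rw [add_sub_cancel_right] at e1
    linarith [sqNorm_nonneg (A *ᵥ β + w + w)]
  have h8 : αfe * σ ^ 2 ≤ |αfe| * σ ^ 2 :=
    mul_le_mul_of_nonneg_right (le_abs_self _) (sq_nonneg σ)
  linarith

end Detection

/-! ### The algorithms along one path -/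

/-- A realization of the model on which the almost sure properties hold. -/
structure IsRegularPath (A : Matrix (Fin n) (Fin m) ℝ) (σ : ℝ) (N : ℕ → Finset (Fin m))
    (x : ℕ → Fin m → ℝ) (w y : ℕ → Fin n → ℝ) : Prop where
  obs : ∀ t, y (t + 1) = A *ᵥ x (t + 1) + w (t + 1)
  supported : ∀ t, SupportedOn (N t) (x t)
  noise : ∀ t k, |w (t + 1) k| * maxColL1 A ≤ lam m * σ

section Kalman

variable {A : Matrix (Fin n) (Fin m) ℝ} {σ : ℝ} {P : Matrix (Fin m) (Fin m) ℝ}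

lemma supportedOn_kfState {T : Finset (Fin m)} (hP : proj T * P = P) {x : Fin m → ℝ}
    (hx : SupportedOn T x) (y : Fin n → ℝ) : SupportedOn T (kfState A σ P x y) := by
  rw [supportedOn_iff] at hx ⊢
  rw [kfState, Matrix.mulVec_add, Matrix.sub_mulVec, Matrix.one_mulVec, Matrix.mulVec_sub, hx,
    Matrix.mulVec_mulVec, Matrix.mulVec_mulVec, ← Matrix.mul_assoc, proj_mul_gain hP]

lemma nrm_mulVec_kfState_le (hσ : 0 < σ) (hP : P.PosSemidef) (x : Fin m → ℝ) (y : Fin n → ℝ) :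
    nrm (A *ᵥ kfState A σ P x y) ≤ nrm (A *ᵥ x) + nrm y := by
  have h : A *ᵥ kfState A σ P x y =
      (1 - A * gain A σ P) *ᵥ (A *ᵥ x) + (A * gain A σ P) *ᵥ y := by
    simp only [kfState, Matrix.mulVec_add, Matrix.mulVec_mulVec, Matrix.mul_sub, Matrix.sub_mul,
      Matrix.mul_one, Matrix.one_mul, Matrix.mul_assoc]
  rw [h]
  exact (nrm_add_le _ _).trans (add_le_add (nrm_le_nrm (sqNorm_mul_gain_le hσ hP _).1)
    (nrm_le_nrm (sqNorm_mul_gain_le hσ hP _).2))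

end Kalman

lemma supportedOn_lsEst (A : Matrix (Fin n) (Fin m) ℝ) (T : Finset (Fin m)) (y : Fin n → ℝ) :
    SupportedOn T (lsEst A T y) := fun i hi => by simp [lsEst, hi]

lemma subset_of_le {N : ℕ → Finset (Fin m)} (h : ∀ t, N t ⊆ N (t + 1)) {s t : ℕ} (hst : s ≤ t) :
    N s ⊆ N t := monotone_nat_of_le_succ (f := N) h hst

section Runs

variable {A : Matrix (Fin n) (Fin m) ℝ} {σ q αfe : ℝ} {N : ℕ → Finset (Fin m)} {S : ℕ}
  {x : ℕ → Fin m → ℝ} {w y : ℕ → Fin n → ℝ} {T0 : Finset (Fin m)}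
  {T : ℕ → Finset (Fin m)} {xhat : ℕ → Fin m → ℝ} {P : ℕ → Matrix (Fin m) (Fin m) ℝ}

/-- The invariants of the genie-aided Kalman filter. -/
lemma gaKF_invariants (hσ : 0 < σ) (hnest : ∀ t, N t ⊆ N (t + 1)) (t : ℕ) :
    SupportedOn (N t) (gaKF A q σ N y t) ∧ IsPosterior A σ (N t) (gaKFCov A q σ N t) ∧
      nrm (A *ᵥ gaKF A q σ N y t) ≤ ∑ k ∈ Finset.range t, nrm (y (k + 1)) := by
  induction t with
  | zero => exact ⟨fun _ _ => rfl, isPosterior_zero _ _ _, by simp [gaKF]⟩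
  | succ t ih =>
    obtain ⟨h1, h2, h3⟩ := ih
    have h2' := h2.mono (hnest t)
    refine ⟨supportedOn_kfState (h2'.proj_mul_pred q subset_rfl) (h1.mono (hnest t)) _,
      h2'.kfCov hσ q subset_rfl, ?_⟩
    rw [Finset.sum_range_succ]
    exact (nrm_mulVec_kfState_le hσ (h2'.pred_posSemidef q _) _ _).trans (by gcongr)

lemma IsRegularPath.residual_eq (h : IsRegularPath A σ N x w y) (t : ℕ) (z : Fin m → ℝ) :
    y (t + 1) - A *ᵥ z = A *ᵥ (x (t + 1) - z) + w (t + 1) := by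
  rw [h.obs, Matrix.mulVec_sub]
  abel

/-- The invariants of a run of KF-CS: there are never any false additions. -/
lemma IsKFCSRun.invariants (hσ : 0 < σ)
    (hA : ripConst A (2 * S) + ropConst A S (2 * S) < 1) (hinj : ∀ t, InjOn A (N t))
    (hnest : ∀ t, N t ⊆ N (t + 1)) (hcard : ∀ t, (N t).card ≤ S)
    (hpath : IsRegularPath A σ N x w y) (hT0 : T0 ⊆ N 0)
    (h : IsKFCSRun A q σ (threshB1 A S σ) αfe T0 y T xhat P) (t : ℕ) :
    T t ⊆ N t ∧ SupportedOn (T t) (xhat t) ∧ IsPosterior A σ (T t) (P t) ∧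
      nrm (A *ᵥ xhat t) ≤ ∑ k ∈ Finset.range t, nrm (y (k + 1)) := by
  induction t with
  | zero =>
    rw [h.T_zero, h.xhat_zero, h.P_zero]
    exact ⟨hT0, fun _ _ => rfl, isPosterior_zero _ _ _, by simp⟩
  | succ t ih =>
    obtain ⟨h1, h2, h3, h4⟩ := ih
    have hTN : T (t + 1) ⊆ N (t + 1) := by
      by_cases hdet : αfe < kfFEN A σ (P t + diagOn q (T t)) (xhat t) (y (t + 1))
      · have hcs := h.detect t hdet
        rw [kfResidual, hpath.residual_eq] at hcs
        refine (hcs.subset_and_mem hσ hA (h1.trans (hnest t)) (hcard _)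
          ((hpath.supported _).sub ?_) (hpath.noise t)).1
        exact (supportedOn_kfState (h3.proj_mul_pred q subset_rfl) h2 _).mono
          (h1.trans (hnest t))
      · rw [h.no_detect t hdet]
        exact h1.trans (hnest t)
    refine ⟨hTN, ?_⟩
    rw [Finset.sum_range_succ]
    by_cases hch : T (t + 1) = T t
    · obtain ⟨hx, hP⟩ := h.kalman t hch
      rw [hx, hP, hch]
      refine ⟨supportedOn_kfState (h3.proj_mul_pred q subset_rfl) h2 _,
        h3.kfCov hσ q subset_rfl, ?_⟩
      exact (nrm_mulVec_kfState_le hσ (h3.pred_posSemidef q _) _ _).trans (by gcongr)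
    · obtain ⟨hx, hP⟩ := h.final_ls t hch
      have hi := (hinj (t + 1)).mono hTN
      rw [hx, hP]
      refine ⟨supportedOn_lsEst _ _ _, isPosterior_lsCov σ hi,
        (nrm_le_nrm (sqNorm_mulVec_lsEst_le hi _)).trans ?_⟩
      have : 0 ≤ ∑ k ∈ Finset.range t, nrm (y (k + 1)) := Finset.sum_nonneg fun _ _ => nrm_nonneg _
      linarith

/-- KF-CS never deletes, and finds every large coordinate. -/
lemma IsKFCSRun.subset_and_mem (hσ : 0 < σ)
    (hA : ripConst A (2 * S) + ropConst A S (2 * S) < 1) (hinj : ∀ t, InjOn A (N t))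
    (hnest : ∀ t, N t ⊆ N (t + 1)) (hcard : ∀ t, (N t).card ≤ S)
    (hpath : IsRegularPath A σ N x w y) (hT0 : T0 ⊆ N 0)
    (h : IsKFCSRun A q σ (threshB1 A S σ) αfe T0 y T xhat P) (t : ℕ) :
    T t ⊆ T (t + 1) ∧ ∀ i, detectionLevel A S σ αfe < x (t + 1) i ^ 2 → i ∈ T (t + 1) := by
  obtain ⟨h1, h2, h3, -⟩ := h.invariants hσ hA hinj hnest hcard hpath hT0 t
  have hrip : ripConst A (2 * S) < 1 := by
    linarith [(ropConst_mem A S (2 * S)).1]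
  set z := kfState A σ (P t + diagOn q (T t)) (xhat t) (y (t + 1))
  have hzT : SupportedOn (T t) z := supportedOn_kfState (h3.proj_mul_pred q subset_rfl) h2 _
  have hβ : SupportedOn (N (t + 1)) (x (t + 1) - z) :=
    (hpath.supported _).sub (hzT.mono (h1.trans (hnest t)))
  by_cases hdet : αfe < kfFEN A σ (P t + diagOn q (T t)) (xhat t) (y (t + 1))
  · have hcs := h.detect t hdet
    rw [kfResidual, hpath.residual_eq] at hcs
    obtain ⟨-, h5, h6⟩ := hcs.subset_and_mem hσ hA (h1.trans (hnest t)) (hcard _) hβ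
      (hpath.noise t)
    refine ⟨h5, fun i hi => ?_⟩
    by_cases hiT : i ∈ T t
    · exact h5 hiT
    · refine h6 i hiT ?_
      rw [Pi.sub_apply, hzT i hiT, sub_zero]
      exact lt_of_detectionLevel_lt hrip hi
  · have hT := h.no_detect t hdet
    refine ⟨hT.symm.subset, fun i hi => ?_⟩
    by_contra hiT
    rw [hT] at hiT
    refine hdet ?_
    have h7 := lt_sqNorm_residual (αfe := αfe) (i := i) hrip (hcard _) hβ (hpath.noise t)
      (by rwa [Pi.sub_apply, hzT i hiT, sub_zero])
    rw [← hpath.residual_eq] at h7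
    have h8 := sqNorm_kfResidual_le hσ (h3.pred_posSemidef q (T t)) (A := A) (xhat t) (y (t + 1))
    have h9 := h7.trans_le h8
    rw [mul_comm] at h9
    exact lt_of_mul_lt_mul_left h9 (sq_nonneg σ)

/-- LS-CS makes no false additions, never deletes, and finds every large coordinate. -/
lemma IsLSCSRun.subset_and_mem (hσ : 0 < σ)
    (hA : ripConst A (2 * S) + ropConst A S (2 * S) < 1)
    (hnest : ∀ t, N t ⊆ N (t + 1)) (hcard : ∀ t, (N t).card ≤ S)
    (hpath : IsRegularPath A σ N x w y) (hT0 : T0 ⊆ N 0)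
    (h : IsLSCSRun A σ (threshB1 A S σ) αfe T0 y T xhat) (t : ℕ) :
    T t ⊆ N t ∧ T t ⊆ T (t + 1) ∧
      ∀ i, detectionLevel A S σ αfe < x (t + 1) i ^ 2 → i ∈ T (t + 1) := by
  have hrip : ripConst A (2 * S) < 1 := by
    linarith [(ropConst_mem A S (2 * S)).1]
  have step : ∀ t, T t ⊆ N t → T (t + 1) ⊆ N (t + 1) ∧ T t ⊆ T (t + 1) ∧
      ∀ i, detectionLevel A S σ αfe < x (t + 1) i ^ 2 → i ∈ T (t + 1) := by
    intro t h1
    set z := lsEst A (T t) (y (t + 1))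
    have hzT : SupportedOn (T t) z := supportedOn_lsEst _ _ _
    have hβ : SupportedOn (N (t + 1)) (x (t + 1) - z) :=
      (hpath.supported _).sub (hzT.mono (h1.trans (hnest t)))
    by_cases hdet : αfe < sqNorm (lsResidual A (T t) (y (t + 1))) / σ ^ 2
    · have hcs := h.detect t hdet
      rw [lsResidual, hpath.residual_eq] at hcs
      obtain ⟨h4, h5, h6⟩ := hcs.subset_and_mem hσ hA (h1.trans (hnest t)) (hcard _) hβ
        (hpath.noise t)
      refine ⟨h4, h5, fun i hi => ?_⟩
      by_cases hiT : i ∈ T t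
      · exact h5 hiT
      · refine h6 i hiT ?_
        rw [Pi.sub_apply, hzT i hiT, sub_zero]
        exact lt_of_detectionLevel_lt hrip hi
    · have hT := h.no_detect t hdet
      refine ⟨hT ▸ h1.trans (hnest t), hT.symm.subset, fun i hi => ?_⟩
      by_contra hiT
      rw [hT] at hiT
      refine hdet ?_
      have h7 := lt_sqNorm_residual (αfe := αfe) (i := i) hrip (hcard _) hβ (hpath.noise t)
        (by rwa [Pi.sub_apply, hzT i hiT, sub_zero])
      rw [← hpath.residual_eq] at h7
      rwa [lsResidual, lt_div_iff₀ (by positivity)]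
  have hsub : ∀ t, T t ⊆ N t := fun t => by
    induction t with
    | zero => rw [h.T_zero]; exact hT0
    | succ t ih => exact (step t ih).1
  exact ⟨hsub t, (step t (hsub t)).2⟩

/-- Once every coordinate of the final support has been large at some time, a support estimate
that never deletes and makes no false additions is equal to the support. -/
lemma support_eq_of_large {M : ℝ} (hsub : ∀ t, T t ⊆ N t) (hmono : ∀ t, T t ⊆ T (t + 1))
    (hfind : ∀ t i, M < x (t + 1) i ^ 2 → i ∈ T (t + 1)) {ta : ℕ}
    (hN : ∀ t, ta ≤ t → N t = N ta) {s : ℕ} (hs : ta ≤ s + 1)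
    (hlarge : ∀ i ∈ N ta, M < x (s + 1) i ^ 2) {t : ℕ} (ht : s + 1 ≤ t) : T t = N ta := by
  refine Finset.Subset.antisymm (by rw [← hN t (hs.trans ht)]; exact hsub t) fun i hi => ?_
  exact subset_of_le hmono ht (hfind s i (hlarge i hi))

/-- Once the support estimate is correct, KF-CS approaches the genie-aided filter exponentially
fast, up to a factor that is linear in time and in the size of the data. -/
lemma exists_gaKF_sub_bound (hσ : 0 < σ) (hq : 0 < q)
    (hA : ripConst A (2 * S) + ropConst A S (2 * S) < 1) (hinj : ∀ t, InjOn A (N t))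
    (hnest : ∀ t, N t ⊆ N (t + 1)) (hcard : ∀ t, (N t).card ≤ S) (hT0 : T0 ⊆ N 0) {ta : ℕ}
    (hN : ∀ t, ta ≤ t → N t = N ta) :
    ∃ C r : ℝ, 0 ≤ C ∧ 0 ≤ r ∧ r < 1 ∧
      ∀ (x : ℕ → Fin m → ℝ) (w y : ℕ → Fin n → ℝ) (T : ℕ → Finset (Fin m))
        (xhat : ℕ → Fin m → ℝ) (P : ℕ → Matrix (Fin m) (Fin m) ℝ) (s t : ℕ),
        IsRegularPath A σ N x w y → IsKFCSRun A q σ (threshB1 A S σ) αfe T0 y T xhat P →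
        ta ≤ s → (∀ t, s ≤ t → T t = N ta) →
        nrm (gaKF A q σ N y (s + t) - xhat (s + t)) ≤
          C * r ^ t * (t + 1) * ∑ k ∈ Finset.range (s + t), nrm (y (k + 1)) := by
  obtain ⟨C, r, hC, hr, hr1, hbound⟩ := exists_kf_sub_bound (hinj ta) hσ hq
  obtain ⟨a, ha, hLa⟩ := exists_nrm_mulVec_le (lsMat A (N ta))
  refine ⟨C * (a + 1), r, by positivity, hr, hr1, ?_⟩
  intro x w y T xhat P s t hpath hrun hs hT
  have hga := fun t => gaKF_invariants (A := A) (q := q) (y := y) hσ hnest t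
  have hkf := fun t => hrun.invariants hσ hA hinj hnest hcard hpath hT0 t
  set Y : ℕ → ℝ := fun t => ∑ k ∈ Finset.range t, nrm (y (k + 1)) with hY
  have hYmono : Monotone Y := monotone_nat_of_le_succ fun t => by
    simp only [hY, Finset.sum_range_succ]
    linarith [nrm_nonneg (y (t + 1))]
  have hY0 : ∀ t, 0 ≤ Y t := fun t => Finset.sum_nonneg fun _ _ => nrm_nonneg _
  have hrec : ∀ {v : Fin m → ℝ} {k : ℕ}, SupportedOn (N ta) v → nrm (A *ᵥ v) ≤ Y k → k ≤ s + t →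
      nrm v ≤ (a + 1) * Y (s + t) := by
    intro v k hv hvY hk
    have e : v = lsMat A (N ta) *ᵥ (A *ᵥ v) := by
      nth_rewrite 2 [← supportedOn_iff.mp hv]
      rw [Matrix.mulVec_mulVec, Matrix.mulVec_mulVec,
        lsMat_mul_mul_proj (hinj ta), supportedOn_iff.mp hv]
    calc nrm v ≤ a * nrm (A *ᵥ v) := by nth_rewrite 1 [e]; exact hLa _
      _ ≤ a * Y (s + t) := mul_le_mul_of_nonneg_left (hvY.trans (hYmono hk)) ha
      _ ≤ (a + 1) * Y (s + t) := by linarith [hY0 (s + t)]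
  have hNs : ∀ k, N (s + k) = N ta := fun k => hN _ (by omega)
  have hTs : ∀ k, T (s + k) = N ta := fun k => hT _ (by omega)
  have hsuppg : ∀ k, SupportedOn (N ta) (gaKF A q σ N y (s + k)) := fun k => hNs k ▸ (hga _).1
  have hsuppk : ∀ k, SupportedOn (N ta) (xhat (s + k)) := fun k => hTs k ▸ (hkf _).2.1
  have h1 : IsRiccati A q σ (N ta) fun k => gaKFCov A q σ N (s + k) :=
    ⟨hNs 0 ▸ (hga (s + 0)).2.1, fun k => by rw [← hNs (k + 1)]; rfl⟩
  have h2 : IsRiccati A q σ (N ta) fun k => P (s + k) :=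
    ⟨hTs 0 ▸ (hkf (s + 0)).2.2.1, fun k => by
      have := (hrun.kalman (s + k) (by rw [add_assoc, hTs, hTs])).2
      rwa [add_assoc, hTs] at this⟩
  have := hbound _ _ (fun k => gaKF A q σ N y (s + k)) (fun k => xhat (s + k))
    (fun k => y (s + k + 1)) t ((a + 1) * Y (s + t)) h1 h2
    (fun k => by rw [← hNs (k + 1)]; rfl)
    (fun k => by
      have := (hrun.kalman (s + k) (by rw [add_assoc, hTs, hTs])).1
      rwa [add_assoc, hTs] at this)
    (hsuppg 0) (hsuppk 0) (mul_nonneg (by positivity) (hY0 _))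
    (hrec (hsuppg 0) (hga (s + 0)).2.2 (by omega)) (hrec (hsuppk 0) (hkf (s + 0)).2.2.2 (by omega))
    (fun k hk => hrec (hsuppk k) (hkf (s + k)).2.2.2 (by omega))
    (fun k hk => by
      have h3 : nrm (y (s + k + 1)) ≤ Y (s + t) :=
        Finset.single_le_sum (f := fun k => nrm (y (k + 1))) (fun _ _ => nrm_nonneg _)
          (Finset.mem_range.mpr (by omega))
      nlinarith [mul_nonneg ha (hY0 (s + t))])
  refine this.trans (le_of_eq ?_)
  ring

end Runs

/-! ### Growth of the signal and of the data -/

open Topology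

lemma gaussianReal_sq_le {v : NNReal} (hv : v ≠ 0) (M : ℝ) :
    gaussianReal 0 v {z | z ^ 2 ≤ M} ≤ ENNReal.ofReal ((√(2 * Real.pi * v))⁻¹ * (2 * √M)) := by
  have hsub : {z : ℝ | z ^ 2 ≤ M} ⊆ Set.Icc (-√M) (√M) := fun z hz => by
    have := Real.abs_le_sqrt hz
    exact abs_le.mp this
  refine (measure_mono hsub).trans ?_
  rw [gaussianReal_apply 0 hv]
  calc ∫⁻ z in Set.Icc (-√M) (√M), gaussianPDF 0 v z
      ≤ ∫⁻ _z in Set.Icc (-√M) (√M), ENNReal.ofReal ((√(2 * Real.pi * v))⁻¹) := by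
        refine lintegral_mono fun z => ENNReal.ofReal_le_ofReal ?_
        rw [gaussianPDFReal]
        refine mul_le_of_le_one_right (by positivity) (Real.exp_le_one_iff.mpr ?_)
        rw [neg_div]
        exact neg_nonpos.mpr (by positivity)
    _ = _ := by
        rw [lintegral_const, Measure.restrict_apply_univ, Real.volume_Icc,
          ← ENNReal.ofReal_mul (by positivity)]
        congr 2
        ring

section Model

variable {Ω : Type*} [MeasurableSpace Ω] {μ : Measure Ω}
  {A : Matrix (Fin n) (Fin m) ℝ} {σsys σobs : ℝ} {N : ℕ → Finset (Fin m)}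
  {x ν : ℕ → Ω → Fin m → ℝ} {w y : ℕ → Ω → Fin n → ℝ}

/-- The variance of the coordinate `i` of the law `𝒩(0, σ² I_T)`. -/
noncomputable def coordVar (σ : ℝ) (T : Finset (Fin m)) (i : Fin m) : NNReal :=
  if i ∈ T then Real.toNNReal (σ ^ 2) else 0

namespace IsModel

lemma map_coord (h : IsModel μ A σsys σobs N x ν w y) (t : ℕ) (i : Fin m) :
    μ.map (fun ω => ν (t + 1) ω i) = gaussianReal 0 (coordVar σsys (N (t + 1)) i) := by
  have h1 : μ.map (fun ω => ν (t + 1) ω i) = (μ.map (ν (t + 1))).map (Function.eval i) := by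
    rw [Measure.map_map (measurable_pi_apply i) (h.meas_ν t)]
    rfl
  rw [h1, h.law_ν, gaussOn]
  exact (measurePreserving_eval (fun i => gaussianReal 0
    (if i ∈ N (t + 1) then Real.toNNReal (σsys ^ 2) else 0)) i).map_eq

lemma x_eq_sum (h : IsModel μ A σsys σobs N x ν w y) (t : ℕ) (ω : Ω) :
    x t ω = ∑ k ∈ Finset.range t, ν (k + 1) ω := by
  induction t with
  | zero => simpa using h.x_zero ω
  | succ t ih => rw [h.x_succ, ih, Finset.sum_range_succ]

lemma measurable_x (h : IsModel μ A σsys σobs N x ν w y) (t : ℕ) : Measurable (x t) := by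
  rw [show x t = fun ω => ∑ k ∈ Finset.range t, ν (k + 1) ω from funext (h.x_eq_sum t)]
  exact Finset.measurable_fun_sum _ fun k _ => h.meas_ν k

lemma measurable_y (h : IsModel μ A σsys σobs N x ν w y) (t : ℕ) : Measurable (y (t + 1)) := by
  rw [show y (t + 1) = fun ω => A *ᵥ x (t + 1) ω + w (t + 1) ω from funext (h.obs t)]
  have hc : Continuous fun v : Fin m → ℝ => A *ᵥ v := by fun_prop
  exact (hc.measurable.comp (h.measurable_x _)).add (h.meas_w t)

lemma iIndepFun_coord (h : IsModel μ A σsys σobs N x ν w y) (i : Fin m) :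
    iIndepFun (fun (t : ℕ) ω => ν (t + 1) ω i) μ := by
  have h1 : iIndepFun (fun (t : ℕ) => ν (t + 1)) μ := by
    rw [iIndepFun_iff_iIndep]
    exact h.indep.precomp (g := Sum.inl) Sum.inl_injective
  exact h1.comp (fun _ v => v i) fun _ => measurable_pi_apply i

/-- The coordinates of the random walk are Gaussian. -/
lemma map_x_coord (h : IsModel μ A σsys σobs N x ν w y) [IsProbabilityMeasure μ] (t : ℕ)
    (i : Fin m) : μ.map (fun ω => x t ω i) =
      gaussianReal 0 (∑ k ∈ Finset.range t, coordVar σsys (N (k + 1)) i) := by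
  induction t with
  | zero =>
    simp [h.x_zero]
  | succ t ih =>
    have e : ∀ t, (fun ω => x t ω i) = ∑ k ∈ Finset.range t, fun ω => ν (k + 1) ω i := fun t => by
      ext ω
      rw [h.x_eq_sum]
      simp
    have hind := (h.iIndepFun_coord i).indepFun_sum_range_succ
      (fun k => (measurable_pi_apply i).comp (h.meas_ν k)) t
    rw [← e t] at hind
    have := gaussianReal_add_gaussianReal_of_indepFun hind ih (h.map_coord t i)
    rw [add_zero, ← Finset.sum_range_succ (fun k => coordVar σsys (N (k + 1)) i)] at this
    rw [← this]
    congr 1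
    ext ω
    simp [h.x_succ]

/-- The coordinates in the final support leave every bounded set in probability. -/
lemma tendsto_measure_x_sq_le (h : IsModel μ A σsys σobs N x ν w y) [IsProbabilityMeasure μ]
    (hsys : 0 < σsys) {ta : ℕ} (hN : ∀ t, ta ≤ t → N t = N ta) {i : Fin m} (hi : i ∈ N ta)
    (M : ℝ) : Tendsto (fun t => μ {ω | x t ω i ^ 2 ≤ M}) atTop (𝓝 0) := by
  set V : ℕ → NNReal := fun t => ∑ k ∈ Finset.range t, coordVar σsys (N (k + 1)) i
  have hs : 0 < σsys ^ 2 := by positivity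
  have hV : ∀ t : ℕ, (t : ℝ) * σsys ^ 2 ≤ V (ta + t) := fun t => by
    induction t with
    | zero => simp
    | succ t ih =>
      have e : V (ta + (t + 1)) = V (ta + t) + Real.toNNReal (σsys ^ 2) := by
        simp only [V]
        rw [← add_assoc, Finset.sum_range_succ]
        simp [coordVar, hN (ta + t + 1) (by omega), hi]
      rw [e, NNReal.coe_add, Real.coe_toNNReal _ hs.le]
      push_cast
      linarith
  have hVtop : Tendsto (fun t => (V t : ℝ)) atTop atTop := by
    rw [← tendsto_add_atTop_iff_nat ta]
    refine tendsto_atTop_mono (fun t => ?_)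
      (tendsto_natCast_atTop_atTop.atTop_mul_const hs)
    rw [add_comm]
    exact hV t
  have hlim : Tendsto (fun t => ENNReal.ofReal ((√(2 * Real.pi * V t))⁻¹ * (2 * √M))) atTop
      (𝓝 0) := by
    rw [← ENNReal.ofReal_zero]
    refine ENNReal.tendsto_ofReal ?_
    rw [← zero_mul (2 * √M)]
    refine Tendsto.mul_const _ (tendsto_inv_atTop_zero.comp (Real.tendsto_sqrt_atTop.comp ?_))
    exact hVtop.const_mul_atTop (by positivity)
  refine tendsto_of_tendsto_of_tendsto_of_le_of_le' tendsto_const_nhds hlim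
    (Eventually.of_forall fun _ => zero_le) ?_
  filter_upwards [hVtop.eventually_gt_atTop 0] with t ht
  have hset : MeasurableSet {z : ℝ | z ^ 2 ≤ M} :=
    measurableSet_le (by fun_prop) measurable_const
  have e : μ {ω | x t ω i ^ 2 ≤ M} = μ.map (fun ω => x t ω i) {z | z ^ 2 ≤ M} := by
    have hm : Measurable fun ω => x t ω i := (measurable_pi_apply i).comp (h.measurable_x t)
    rw [Measure.map_apply hm hset]
    rfl
  rw [e, h.map_x_coord]
  exact gaussianReal_sq_le (by exact_mod_cast ht.ne') M

/-- Almost every realization is regular. -/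
lemma ae_isRegularPath (h : IsModel μ A σsys σobs N x ν w y) (hnest : ∀ t, N t ⊆ N (t + 1)) :
    ∀ᵐ ω ∂μ, IsRegularPath A σobs N (fun t => x t ω) (fun t => w t ω) (fun t => y t ω) := by
  have hν : ∀ᵐ ω ∂μ, ∀ t i, i ∉ N (t + 1) → ν (t + 1) ω i = 0 := by
    refine ae_all_iff.mpr fun t => ae_all_iff.mpr fun i => ?_
    by_cases hi : i ∈ N (t + 1)
    · exact Eventually.of_forall fun ω hn => absurd hi hn
    · have hmap := h.map_coord t i
      rw [coordVar, if_neg hi, gaussianReal_zero_var] at hmap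
      have h1 : ∀ᵐ z ∂(μ.map fun ω => ν (t + 1) ω i), z = 0 := by
        rw [hmap, ae_dirac_eq]
        exact rfl
      filter_upwards [ae_of_ae_map ((measurable_pi_apply i).comp (h.meas_ν t)).aemeasurable h1]
        with ω hω _ using hω
  filter_upwards [hν, ae_all_iff.mpr h.bdd_w] with ω h1 h2
  refine ⟨fun t => h.obs t ω, fun t i hi => ?_, h2⟩
  rw [h.x_eq_sum, Finset.sum_apply]
  refine Finset.sum_eq_zero fun k hk => h1 k i fun hik => hi ?_
  exact subset_of_le hnest (Finset.mem_range.mp hk) hik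

end IsModel

lemma measurable_nrm {ι : Type*} [Fintype ι] : Measurable (nrm : (ι → ℝ) → ℝ) := by
  have : Continuous (nrm : (ι → ℝ) → ℝ) := by
    unfold nrm sqNorm
    fun_prop
  exact this.measurable

namespace IsModel

/-- The system noise has uniformly bounded first moments. -/
lemma exists_lintegral_nrm_ν_le (h : IsModel μ A σsys σobs N x ν w y) :
    ∃ c : ENNReal, c ≠ ⊤ ∧ ∀ t, ∫⁻ ω, ENNReal.ofReal (nrm (ν (t + 1) ω)) ∂μ ≤ c := by
  set G : NNReal → ENNReal := fun v => ∫⁻ z, ENNReal.ofReal |z| ∂gaussianReal 0 v with hG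
  have hGfin : ∀ v, G v ≠ ⊤ := fun v => by
    have hint : Integrable id (gaussianReal 0 v) :=
      memLp_one_iff_integrable.mp (memLp_id_gaussianReal 1)
    exact hint.abs.lintegral_lt_top.ne
  refine ⟨∑ _i : Fin m, (G (Real.toNNReal (σsys ^ 2)) + G 0), ?_, fun t => ?_⟩
  · exact ENNReal.sum_ne_top.mpr fun _ _ => ENNReal.add_ne_top.mpr ⟨hGfin _, hGfin _⟩
  · have hmeas : ∀ i, Measurable fun ω => ν (t + 1) ω i := fun i =>
      (measurable_pi_apply i).comp (h.meas_ν t)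
    calc ∫⁻ ω, ENNReal.ofReal (nrm (ν (t + 1) ω)) ∂μ
        ≤ ∫⁻ ω, ∑ i, ENNReal.ofReal |ν (t + 1) ω i| ∂μ := by
          refine lintegral_mono fun ω => ?_
          rw [← ENNReal.ofReal_sum_of_nonneg fun _ _ => abs_nonneg _]
          exact ENNReal.ofReal_le_ofReal (nrm_le_sum_abs _)
      _ = ∑ i, ∫⁻ ω, ENNReal.ofReal |ν (t + 1) ω i| ∂μ :=
          lintegral_finsetSum _ fun i _ => by
            have := hmeas i
            fun_prop
      _ ≤ _ := by
          refine Finset.sum_le_sum fun i _ => ?_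
          have e : ∫⁻ ω, ENNReal.ofReal |ν (t + 1) ω i| ∂μ = G (coordVar σsys (N (t + 1)) i) := by
            simp only [hG]
            rw [← h.map_coord t i]
            exact (lintegral_map (f := fun z : ℝ => ENNReal.ofReal |z|) (by fun_prop)
              (hmeas i)).symm
          rw [e, coordVar]
          split_ifs
          · exact le_self_add
          · exact le_add_self

/-- The observation noise has bounded first moments, because its variances are finite. -/
lemma lintegral_nrm_w_ne_top (h : IsModel μ A σsys σobs N x ν w y) [IsProbabilityMeasure μ]
    (hobs : 0 < σobs) : ∫⁻ ω, ENNReal.ofReal (nrm (w 1 ω)) ∂μ ≠ ⊤ := by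
  -- A nonzero Bochner integral certifies integrability.
  have hint : ∀ i, Integrable (fun ω => w 1 ω i ^ 2) μ := fun i => by
    by_contra hn
    have h1 := h.cov_w 0 i i
    simp only [zero_add, ← sq] at h1
    rw [integral_undef hn, if_true] at h1
    exact (pow_pos hobs 2).ne h1
  have hsum : Integrable (fun ω => 1 + sqNorm (w 1 ω)) μ :=
    (integrable_const 1).add (integrable_finsetSum _ fun i _ => hint i)
  refine ne_top_of_le_ne_top hsum.lintegral_lt_top.ne (lintegral_mono fun ω => ?_)
  refine ENNReal.ofReal_le_ofReal ?_
  nlinarith [nrm_sq (w 1 ω), sq_nonneg (nrm (w 1 ω) - 1), nrm_nonneg (w 1 ω)]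

/-- The first moments of the data grow at most polynomially. -/
lemma exists_lintegral_data_le (h : IsModel μ A σsys σobs N x ν w y) [IsProbabilityMeasure μ]
    (hobs : 0 < σobs) : ∃ c : ENNReal, c ≠ ⊤ ∧ ∀ t : ℕ,
      ∫⁻ ω, ENNReal.ofReal (∑ k ∈ Finset.range t, nrm (y (k + 1) ω)) ∂μ ≤
        (t : ENNReal) ^ 2 * c := by
  obtain ⟨c, hc, hν⟩ := h.exists_lintegral_nrm_ν_le
  obtain ⟨a, ha, hAa⟩ := exists_nrm_mulVec_le A
  set cw := ∫⁻ ω, ENNReal.ofReal (nrm (w 1 ω)) ∂μ with hcw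
  have hcw' := h.lintegral_nrm_w_ne_top hobs
  have hw : ∀ t, ∫⁻ ω, ENNReal.ofReal (nrm (w (t + 1) ω)) ∂μ = cw := fun t =>
    ((h.ident_w t).comp (u := fun v => ENNReal.ofReal (nrm v))
      measurable_nrm.ennreal_ofReal).lintegral_eq
  have hmx : ∀ t, Measurable fun ω => ENNReal.ofReal (nrm (x t ω)) := fun t =>
    (measurable_nrm.comp (h.measurable_x t)).ennreal_ofReal
  have hx : ∀ t : ℕ, ∫⁻ ω, ENNReal.ofReal (nrm (x t ω)) ∂μ ≤ t * c := fun t => by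
    induction t with
    | zero => simp [h.x_zero]
    | succ t ih =>
      calc ∫⁻ ω, ENNReal.ofReal (nrm (x (t + 1) ω)) ∂μ
          ≤ ∫⁻ ω, (ENNReal.ofReal (nrm (x t ω)) + ENNReal.ofReal (nrm (ν (t + 1) ω))) ∂μ := by
            refine lintegral_mono fun ω => ?_
            rw [← ENNReal.ofReal_add (nrm_nonneg _) (nrm_nonneg _), h.x_succ]
            exact ENNReal.ofReal_le_ofReal (nrm_add_le _ _)
        _ = _ := lintegral_add_left (hmx t) _
        _ ≤ t * c + c := add_le_add ih (hν t)
        _ = _ := by push_cast; ring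
  have hy : ∀ t : ℕ, ∫⁻ ω, ENNReal.ofReal (nrm (y (t + 1) ω)) ∂μ ≤
      (t + 1 : ℕ) * (ENNReal.ofReal a * c + cw) := fun t => by
    calc ∫⁻ ω, ENNReal.ofReal (nrm (y (t + 1) ω)) ∂μ
        ≤ ∫⁻ ω, (ENNReal.ofReal a * ENNReal.ofReal (nrm (x (t + 1) ω)) +
            ENNReal.ofReal (nrm (w (t + 1) ω))) ∂μ := by
          refine lintegral_mono fun ω => ?_
          rw [← ENNReal.ofReal_mul ha, ← ENNReal.ofReal_add (mul_nonneg ha (nrm_nonneg _))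
            (nrm_nonneg _), h.obs]
          exact ENNReal.ofReal_le_ofReal ((nrm_add_le _ _).trans (by gcongr; exact hAa _))
      _ = ENNReal.ofReal a * ∫⁻ ω, ENNReal.ofReal (nrm (x (t + 1) ω)) ∂μ + cw := by
          rw [lintegral_add_left ((hmx _).const_mul _), lintegral_const_mul _ (hmx _), hw]
      _ ≤ ENNReal.ofReal a * ((t + 1 : ℕ) * c) + (t + 1 : ℕ) * cw := by
          refine add_le_add (mul_le_mul_right (hx _) _) (le_mul_of_one_le_left zero_le ?_)
          exact_mod_cast Nat.le_add_left 1 t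
      _ = _ := by ring
  refine ⟨ENNReal.ofReal a * c + cw, ENNReal.add_ne_top.mpr
    ⟨ENNReal.mul_ne_top ENNReal.ofReal_ne_top hc, hcw'⟩, fun t => ?_⟩
  calc ∫⁻ ω, ENNReal.ofReal (∑ k ∈ Finset.range t, nrm (y (k + 1) ω)) ∂μ
      = ∑ k ∈ Finset.range t, ∫⁻ ω, ENNReal.ofReal (nrm (y (k + 1) ω)) ∂μ := by
        have hm : ∀ k, Measurable fun ω => ENNReal.ofReal (nrm (y (k + 1) ω)) := fun k =>
          (measurable_nrm.comp (h.measurable_y k)).ennreal_ofReal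
        rw [← lintegral_finsetSum _ fun k _ => hm k]
        refine lintegral_congr fun ω => ?_
        exact ENNReal.ofReal_sum_of_nonneg fun _ _ => nrm_nonneg _
    _ ≤ ∑ _k ∈ Finset.range t, (t : ENNReal) * (ENNReal.ofReal a * c + cw) := by
        refine Finset.sum_le_sum fun k hk => (hy k).trans (mul_le_mul_left ?_ _)
        exact_mod_cast Finset.mem_range.mp hk
    _ = _ := by
        rw [Finset.sum_const, Finset.card_range, nsmul_eq_mul]
        ring

/-- With probability tending to one, every coordinate of the final support is large. -/
lemma tendsto_measure_not_large (h : IsModel μ A σsys σobs N x ν w y) [IsProbabilityMeasure μ]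
    (hsys : 0 < σsys) {ta : ℕ} (hN : ∀ t, ta ≤ t → N t = N ta) (M : ℝ) :
    Tendsto (fun t => μ {ω | ¬ ∀ i ∈ N ta, M < x t ω i ^ 2}) atTop (𝓝 0) := by
  have hsum : Tendsto (fun t => ∑ i ∈ N ta, μ {ω | x t ω i ^ 2 ≤ M}) atTop (𝓝 0) := by
    rw [← Finset.sum_const_zero (s := N ta) (ι := Fin m)]
    exact tendsto_finsetSum _ fun i hi => h.tendsto_measure_x_sq_le hsys hN hi M
  refine tendsto_of_tendsto_of_tendsto_of_le_of_le tendsto_const_nhds hsum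
    (fun _ => zero_le) fun t => ?_
  refine (measure_mono fun ω hω => ?_).trans (measure_biUnion_finset_le (N ta) _)
  simpa using hω

end IsModel

end Model

/-! ### Convergence in probability -/

lemma tendsto_geometric_mul_polynomial {r : ℝ} (hr : 0 ≤ r) (hr1 : r < 1) (s : ℕ) (C : ℝ)
    (hC : 0 ≤ C) :
    Tendsto (fun j : ℕ => C * r ^ j * (j + 1) * ((s + j : ℕ) : ℝ) ^ 2) atTop (nhds 0) := by
  have habs : |r| < 1 := by rwa [abs_of_nonneg hr]
  have h3 := tendsto_pow_const_mul_const_pow_of_abs_lt_one 3 habs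
  have h0 := tendsto_pow_atTop_nhds_zero_of_lt_one hr hr1
  have hlim := (h3.add h0).const_mul (C * (4 * (s + 1 : ℝ) ^ 2))
  rw [add_zero, mul_zero] at hlim
  refine squeeze_zero (fun j => by positivity) (fun j => ?_) hlim
  have hj : (0 : ℝ) ≤ j := by positivity
  have hs : (0 : ℝ) ≤ s := by positivity
  have h1 : ((s + j : ℕ) : ℝ) ≤ (s + 1) * (j + 1) := by
    push_cast
    nlinarith [mul_nonneg hs hj]
  have h2 : ((s + j : ℕ) : ℝ) ^ 2 ≤ ((s + 1) * (j + 1)) ^ 2 :=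
    pow_le_pow_left₀ (by positivity) h1 2
  have h4 : ((j : ℝ) + 1) ^ 3 ≤ 4 * ((j : ℝ) ^ 3 + 1) := by
    nlinarith [mul_nonneg (add_nonneg hj zero_le_one) (sq_nonneg ((j : ℝ) - 1))]
  calc C * r ^ j * (j + 1) * ((s + j : ℕ) : ℝ) ^ 2
      ≤ C * r ^ j * (j + 1) * ((s + 1) * (j + 1)) ^ 2 := by gcongr
    _ = C * r ^ j * (s + 1) ^ 2 * (j + 1) ^ 3 := by ring
    _ ≤ C * r ^ j * (s + 1) ^ 2 * (4 * ((j : ℝ) ^ 3 + 1)) := by gcongr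
    _ = _ := by ring

lemma measure_le_of_ae_imp {Ω : Type*} [MeasurableSpace Ω] {μ : Measure Ω} {s t : Set Ω}
    (h : ∀ᵐ ω ∂μ, ω ∈ s → ω ∈ t) : μ s ≤ μ t := measure_mono_ae h

/-- A random bound with a geometric factor and polynomially growing first moments tends to zero
in probability. -/
lemma tendsto_measure_geometric {Ω : Type*} [MeasurableSpace Ω] {μ : Measure Ω}
    {Y : ℕ → Ω → ℝ} {c : ENNReal} (hc : c ≠ ⊤)
    (hY : ∀ t, ∫⁻ ω, ENNReal.ofReal (Y t ω) ∂μ ≤ (t : ENNReal) ^ 2 * c)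
    (hmeas : ∀ t, Measurable (Y t)) {C r ε : ℝ} (hC : 0 ≤ C) (hr : 0 ≤ r) (hr1 : r < 1)
    (hε : 0 < ε) (s : ℕ) :
    Tendsto (fun j : ℕ => μ {ω | ε ≤ C * r ^ j * (j + 1) * Y (s + j) ω}) atTop (nhds 0) := by
  have hlim := ((tendsto_geometric_mul_polynomial hr hr1 s C hC).mul_const
    (c.toReal / ε))
  rw [zero_mul] at hlim
  have hlim' := ENNReal.tendsto_ofReal hlim
  rw [ENNReal.ofReal_zero] at hlim'
  refine tendsto_of_tendsto_of_tendsto_of_le_of_le tendsto_const_nhds hlim' (fun _ => zero_le)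
    fun j => ?_
  set D := C * r ^ j * ((j : ℝ) + 1) with hD
  have hD0 : 0 ≤ D := by positivity
  have hm : Measurable fun ω => ENNReal.ofReal (Y (s + j) ω) := (hmeas _).ennreal_ofReal
  have h1 : μ {ω | ε ≤ D * Y (s + j) ω} ≤
      μ {ω | ENNReal.ofReal ε ≤ ENNReal.ofReal D * ENNReal.ofReal (Y (s + j) ω)} :=
    measure_mono fun ω hω => by
      rw [Set.mem_ofPred_eq, ← ENNReal.ofReal_mul hD0]
      exact ENNReal.ofReal_le_ofReal hω
  have h2 := meas_ge_le_lintegral_div (μ := μ) (hm.const_mul (ENNReal.ofReal D)).aemeasurable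
    (ENNReal.ofReal_pos.mpr hε).ne' ENNReal.ofReal_ne_top
  refine h1.trans (h2.trans ?_)
  rw [lintegral_const_mul _ hm]
  calc (ENNReal.ofReal D * ∫⁻ ω, ENNReal.ofReal (Y (s + j) ω) ∂μ) / ENNReal.ofReal ε
      ≤ ENNReal.ofReal D * (((s + j : ℕ) : ENNReal) ^ 2 * c) / ENNReal.ofReal ε := by
        gcongr
        exact hY _
    _ = ENNReal.ofReal (D * ((s + j : ℕ) : ℝ) ^ 2 * (c.toReal / ε)) := by
        rw [← ENNReal.ofReal_natCast, ← ENNReal.ofReal_pow (by positivity),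
          ← ENNReal.ofReal_toReal hc, ← ENNReal.ofReal_mul (by positivity),
          ← ENNReal.ofReal_mul hD0, ← ENNReal.ofReal_div_of_pos hε,
          ENNReal.toReal_ofReal (by positivity)]
        congr 1
        ring

end KFCS

theorem theorem2 {m n : ℕ} (A : Matrix (Fin n) (Fin m) ℝ) (σsys σobs : ℝ)
    (hsys : 0 < σsys) (hobs : 0 < σobs)
    {Ω : Type*} [MeasurableSpace Ω] (μ : Measure Ω) [IsProbabilityMeasure μ]
    (N : ℕ → Finset (Fin m)) (x ν : ℕ → Ω → Fin m → ℝ) (w y : ℕ → Ω → Fin n → ℝ)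
    (hmodel : KFCS.IsModel μ A σsys σobs N x ν w y)
    (Smax Sfa : ℕ)
    (hnest : ∀ t, N t ⊆ N (t + 1)) (hcard : ∀ t, (N t).card ≤ Smax)
    (hδ : KFCS.ripConst A (Smax + Sfa) < 1)
    (hδ' : KFCS.ripConst A (2 * Smax) + KFCS.ripConst A (3 * Smax) < 1)
    (hadd : ∃ tamax : ℕ, ∀ t, tamax ≤ t → N t = N tamax)
    (αa : ℝ) (hαa : αa = KFCS.threshB1 A Smax σobs)
    (αfe : ℝ) (T0 : Finset (Fin m)) (hT0 : T0 = ∅ ∨ T0 = N 0) :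
    (∀ (T : ℕ → Ω → Finset (Fin m)) (xhat : ℕ → Ω → Fin m → ℝ)
        (P : ℕ → Ω → Matrix (Fin m) (Fin m) ℝ),
      (∀ ω, KFCS.IsKFCSRun A σsys σobs αa αfe T0 (fun t => y t ω)
        (fun t => T t ω) (fun t => xhat t ω) (fun t => P t ω)) →
      (∀ t, ∀ᵐ ω ∂μ, (T t ω \ N t).card ≤ Sfa) →
      TendstoInMeasure μ
        (fun t ω => KFCS.gaKF A σsys σobs N (fun s => y s ω) t - xhat t ω) atTop
        (fun _ => 0)) ∧
    (∀ (T : ℕ → Ω → Finset (Fin m)) (xhat : ℕ → Ω → Fin m → ℝ),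
      (∀ ω, KFCS.IsLSCSRun A σobs αa αfe T0 (fun t => y t ω)
        (fun t => T t ω) (fun t => xhat t ω)) →
      (∀ t, ∀ᵐ ω ∂μ, (T t ω \ N t).card ≤ Sfa) →
      TendstoInMeasure μ
        (fun t ω => KFCS.lsEst A (N t) (y t ω) - xhat t ω) atTop
        (fun _ => 0)) := by
  obtain ⟨ta, hN⟩ := hadd
  subst hαa
  have hrop : KFCS.ripConst A (2 * Smax) + KFCS.ropConst A Smax (2 * Smax) < 1 := by
    have h1 := KFCS.ropConst_le_ripConst A Smax (2 * Smax)
    rw [show Smax + 2 * Smax = 3 * Smax by ring] at h1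
    linarith
  have hrip : KFCS.ripConst A (2 * Smax) < 1 := by
    linarith [(KFCS.ropConst_mem A Smax (2 * Smax)).1]
  have hinj : ∀ t, KFCS.InjOn A (N t) := fun t =>
    KFCS.injOn_of_ripConst_lt hrip ((hcard t).trans (by omega))
  have hT0' : T0 ⊆ N 0 := by
    rcases hT0 with rfl | rfl
    · exact Finset.empty_subset _
    · exact subset_rfl
  set M := KFCS.detectionLevel A Smax σobs αfe
  have hbad := hmodel.tendsto_measure_not_large hsys hN M
  have hreg := hmodel.ae_isRegularPath hnest
  constructor
  · intro T xhat P hrun _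
    rw [tendstoInMeasure_iff_norm]
    intro ε hε
    obtain ⟨C, r, hC, hr, hr1, hbound⟩ := KFCS.exists_gaKF_sub_bound (αfe := αfe) hobs hsys hrop
      hinj hnest hcard hT0' hN
    obtain ⟨c, hc, hY⟩ := hmodel.exists_lintegral_data_le hobs
    have hmeas : ∀ t, Measurable fun ω => ∑ k ∈ Finset.range t, KFCS.nrm (y (k + 1) ω) :=
      fun t => Finset.measurable_fun_sum _ fun k _ =>
        KFCS.measurable_nrm.comp (hmodel.measurable_y k)
    rw [ENNReal.tendsto_nhds_zero]
    intro η hη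
    -- Choose a time at which the support has been found with high probability; from then on the
    -- two filters run on the same support.
    obtain ⟨s, hs, hsta⟩ :
        ∃ s, μ {ω | ¬ ∀ i ∈ N ta, M < x (s + 1) ω i ^ 2} ≤ η / 2 ∧ ta ≤ s + 1 := by
      have h1 := (ENNReal.tendsto_nhds_zero.mp ((tendsto_add_atTop_iff_nat 1).mpr hbad)) (η / 2)
        (ENNReal.half_pos hη.ne')
      obtain ⟨s, hs⟩ := (h1.and (eventually_ge_atTop ta)).exists
      exact ⟨s, hs.1, by omega⟩
    have h2 := ENNReal.tendsto_nhds_zero.mp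
      (KFCS.tendsto_measure_geometric hc hY hmeas hC hr hr1 hε (s + 1)) (η / 2)
      (ENNReal.half_pos hη.ne')
    obtain ⟨J, hJ⟩ := eventually_atTop.mp h2
    filter_upwards [eventually_ge_atTop (s + 1 + J)] with t ht
    obtain ⟨j, rfl⟩ := Nat.exists_eq_add_of_le ((Nat.le_add_right _ J).trans ht)
    rw [← ENNReal.add_halves η]
    refine le_trans ?_ ((measure_union_le _ _).trans (add_le_add hs (hJ j (by omega))))
    refine KFCS.measure_le_of_ae_imp ?_
    filter_upwards [hreg] with ω hω hmem
    rw [sub_zero] at hmem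
    by_cases hlarge : ∀ i ∈ N ta, M < x (s + 1) ω i ^ 2
    · refine Or.inr (hmem.trans ((KFCS.norm_le_nrm _).trans ?_))
      refine hbound _ _ _ _ _ _ (s + 1) j hω (hrun ω) hsta fun t ht => ?_
      exact KFCS.support_eq_of_large (x := fun t => x t ω)
        (fun t => ((hrun ω).invariants hobs hrop hinj hnest hcard hω hT0' t).1)
        (fun t => ((hrun ω).subset_and_mem hobs hrop hinj hnest hcard hω hT0' t).1)
        (fun t => ((hrun ω).subset_and_mem hobs hrop hinj hnest hcard hω hT0' t).2)
        hN hsta hlarge ht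
    · exact Or.inl hlarge
  · intro T xhat hrun _
    rw [tendstoInMeasure_iff_norm]
    intro ε hε
    refine tendsto_of_tendsto_of_tendsto_of_le_of_le' tendsto_const_nhds hbad
      (Eventually.of_forall fun _ => zero_le) ?_
    filter_upwards [eventually_ge_atTop (ta + 1)] with t ht
    obtain ⟨s, rfl⟩ : ∃ s, t = s + 1 := ⟨t - 1, by omega⟩
    refine KFCS.measure_le_of_ae_imp ?_
    filter_upwards [hreg] with ω hω hmem
    rw [sub_zero] at hmem
    intro hlarge
    have hsub := fun t => (hrun ω).subset_and_mem hobs hrop hnest hcard hω hT0' t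
    have hT := KFCS.support_eq_of_large (x := fun t => x t ω) (fun t => (hsub t).1)
      (fun t => (hsub t).2.1) (fun t => (hsub t).2.2) hN (s := s) (by omega) hlarge le_rfl
    rw [(hrun ω).final_ls s, hT, hN (s + 1) (by omega), sub_self, norm_zero] at hmem
    exact absurd hmem (not_le.mpr hε)
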